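/- **Theorem (the Output Circuit Computation Problem is in FP).** *Circuits.* A Boolean circuit over a finite set $A$ of variables is a finite acyclic digraph in which every node without incoming arcs is labelled by an element of $A$, every other node is labelled by a gate $\wedge$, $\vee$ (any positive number of incoming arcs) or $\neg$ (one incoming arc), and one node is marked as the output; it computes a function $\mathbb{B}^A \to \mathbb{B}$. A variable $a$ *influences* $f : \mathbb{B}^A \to \mathbb{B}$ if $f(x) \ne f(x')$ for some $x, x'$ that differ exactly at $a$. A circuit has *only essential variables* if a variable labels one of its nodes if and only if it influences the function computed. *Modules.* A module $M$ has a finite set $S$ of automata, a finite set $I$ of inputs, disjoint from $S$, and a local function $f_s : \mathbb{B}^{S \cup I} \to \mathbb{B}$ for each $s \in S$. Its interaction digraph on $S$ has an arc from $s$ to $t$ if and only if $s$ influences $f_t$; $M$ is *acyclic* if this digraph has no cycle. An update under an input configuration $i \in \mathbb{B}^I$ replaces the configuration $x \in \mathbb{B}^S$ by $(f_s(x \cdot i))_{s \in S}$. *Output functions.* Let $D = |S|$ and, for $\alpha \in I$ and $1 \le d \le D$, let the variable $\alpha_d$ stand for the value of the input $\alpha$ at the $d$-th update counted backwards from the most recent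 one, which is the update with $d = 1$. For $k \le D$, $x \in \mathbb{B}^S$ and $j \in \mathbb{B}^{I \times \{1,\dots,D\}}$ let $M(x, j_{[1,\dots,k]})$ be the configuration reached from $x$ by $k$ updates with the inputs $j$ of delays $k, k-1, \dots, 1$ in this order. The delay of a function $O : \mathbb{B}^{I \times \{1,\dots,D\}} \to \mathbb{B}$ is the largest $d$ such that some $\alpha_d$ influences $O$ ($0$ if there is none). The output function $O_s$ of $s \in S$ is the function of minimal delay among those functions $O$ for which there is some $k \le D$ with $O(j) = M(x, j_{[1,\dots,k]})_s$ for all $x$ and $j$. *The problem.* Input: an acyclic module $M$, whose local functions are encoded as Boolean circuits, and a set $X \subseteq S$. Promise: the circuits of all the local functions have only essential variables. Output: for each $s \in X$, a Boolean circuit over the variables $I \times \{1,\dots,D\}$ that computes the output function $O_s$. *Claim.* There is a deterministic (multi-stack) Turing machine that, on the encoding of every input satisfying the promise, halts with the encoding of a correct output, in a number of steps bounded by a polynomial in the length of the encoded input. Circuits are encoded as lists of gates with their incoming arcs and the output node, and labels and node numbers are written in unary. -/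

import Mathlib

namespace AutomataNetwork

/-! ### Boolean functions and Boolean circuits -/

/-- The variable `a` influences the Boolean function `f`: there are two affectations which differ
exactly at `a` and on which `f` takes different values. -/
def Influences {A : Type} (f : (A → Bool) → Bool) (a : A) : Prop :=
  ∃ x x' : A → Bool, (∀ b, b ≠ a ↔ x b = x' b) ∧ f x ≠ f x'

/-- A digraph, given by its arcs, is cycle-free. -/
def CycleFree {V : Type} (arc : V → V → Prop) : Prop :=
  ∀ v, ¬ Relation.TransGen arc v v

/-- The label of a node of a circuit, together with the sources of its incoming arcs: a variable
(no incoming arc), a negation (one incoming arc), a conjunction or a disjunction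
(any number of incoming arcs). -/
inductive Gate (A V : Type) : Type
  | var (a : A)
  | not (u : V)
  | and (us : List V)
  | or (us : List V)

namespace Gate

variable {A V : Type}

/-- The sources of the incoming arcs. -/
def preds : Gate A V → List V
  | var _ => []
  | not u => [u]
  | and us => us
  | or us => us

/-- The value computed at a node, from the affectation `x` and the values `val` of the nodes. -/
def eval (x : A → Bool) (val : V → Bool) : Gate A V → Bool
  | var a => x a
  | not u => !(val u)
  | and us => us.all val
  | or us => us.any val

end Gate

/-- A Boolean circuit over the set `A` of variables: an acyclic digraph, with node set
`Fin size`, in which the nodes without incoming arcs are labelled by variables, the other ones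
by `∧`, `∨` or `¬`, with one node marked as the output. -/
structure Circuit (A : Type) where
  size : ℕ
  gate : Fin size → Gate A (Fin size)
  output : Fin size
  var_of_preds_eq_nil : ∀ v, (gate v).preds = [] → ∃ a, gate v = Gate.var a
  acyclic : CycleFree fun u v => u ∈ (gate v).preds

namespace Circuit

variable {A : Type} (C : Circuit A)

theorem wellFounded_arc : WellFounded fun u v => u ∈ (C.gate v).preds := by
  have : IsTrans (Fin C.size) (Relation.TransGen fun u v => u ∈ (C.gate v).preds) :=
    ⟨fun _ _ _ h h' => h.trans h'⟩
  have : Std.Irrefl (Relation.TransGen fun u v => u ∈ (C.gate v).preds) := ⟨C.acyclic⟩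
  have h := Finite.wellFounded_of_trans_of_irrefl
    (Relation.TransGen fun u v => u ∈ (C.gate v).preds)
  exact Subrelation.wf (fun h => Relation.TransGen.single h) h

/-- The value of each node of the circuit, propagated from the affectation `x`. -/
noncomputable def value (x : A → Bool) : Fin C.size → Bool :=
  C.wellFounded_arc.fix fun v ih =>
    (C.gate v).eval x fun u => if h : u ∈ (C.gate v).preds then ih u h else false

/-- The values of the nodes obey the gates. -/
theorem value_eq (x : A → Bool) (v : Fin C.size) :
    C.value x v = (C.gate v).eval x (C.value x) := by
  rw [value, WellFounded.fix_eq]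
  change Gate.eval x (fun u => if u ∈ (C.gate v).preds then C.value x u else false) (C.gate v)
    = (C.gate v).eval x (C.value x)
  cases C.gate v with
  | var a => rfl
  | not u => simp [Gate.eval, Gate.preds]
  | and us => rw [Bool.eq_iff_iff]; simp +contextual [Gate.eval, Gate.preds]
  | or us =>
    rw [Bool.eq_iff_iff]
    change (us.any fun u => if u ∈ us then C.value x u else false) = true ↔ us.any _ = true
    simp +contextual

/-- The Boolean function computed by the circuit. -/
noncomputable def eval (x : A → Bool) : Bool :=
  C.value x C.output

/-- The variable `a` is included in the circuit. -/
def HasVar (a : A) : Prop :=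
  ∃ v, C.gate v = Gate.var a

/-- The circuit only has essential variables: a variable is included in it if and only if it
influences the encoded function. -/
def OnlyEssential : Prop :=
  ∀ a, C.HasVar a ↔ Influences C.eval a

end Circuit

/-! ### Modules and their output functions -/

/-- A module with set of automata `S` and set of inputs `I`: a local function
`𝔹^(S ∪ I) → 𝔹` for each automaton. -/
structure BoolModule (S I : Type) where
  localFn : S → (S ⊕ I → Bool) → Bool

namespace BoolModule

variable {S I : Type} (M : BoolModule S I)

/-- The arcs between automata in the interaction digraph. -/
def Arc (s t : S) : Prop :=
  Influences (M.localFn t) (Sum.inl s)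

/-- The interaction digraph is cycle-free. -/
def Acyclic : Prop :=
  CycleFree M.Arc

/-- The parallel update of the configuration `x` under the input configuration `i`. -/
def update (x : S → Bool) (i : I → Bool) : S → Bool :=
  fun s => M.localFn s (Sum.elim x i)

/-- The configuration reached from `x` by `k` updates, where `j (α, d)`, with `d : Fin D`, is the
value of the input `α` at the `(d + 1)`-th update counted from the last one. The variable
`α_d` of delay `d ∈ {1, …, D}` is thus `(α, d - 1) : I × Fin D`; the values of delay `k` are used
first and those of delay `1` last. -/
def run {D : ℕ} (x : S → Bool) (j : I × Fin D → Bool) (k : ℕ) (hk : k ≤ D) : S → Bool :=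
  (List.ofFn fun d : Fin k => fun α => j (α, Fin.castLE hk d)).foldr (fun i y => M.update y i) x

/-- The function `O` gives the state of `s` after some number `k ≤ D` of updates,
whatever the initial configuration and the inputs are. -/
def GivesState (s : S) {D : ℕ} (O : (I × Fin D → Bool) → Bool) : Prop :=
  ∃ (k : ℕ) (hk : k ≤ D), ∀ x j, O j = M.run x j k hk s

end BoolModule

/-- The delay of a function of the variables `α_1, …, α_D`: the greatest `d` for which some
`α_d` influences it (`0` if there is none). -/
noncomputable def delay {I : Type} {D : ℕ} (O : (I × Fin D → Bool) → Bool) : ℕ :=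
  sSup {d | ∃ (α : I) (e : Fin D), d = e + 1 ∧ Influences O (α, e)}

/-- `O` is the output function of the node `s` on `𝔹^(I × {1, …, D})`: it gives the state of `s`
after some number of updates, with minimal delay. -/
def BoolModule.IsOutputFunction {S I : Type} (M : BoolModule S I) (s : S) {D : ℕ}
    (O : (I × Fin D → Bool) → Bool) : Prop :=
  M.GivesState s O ∧ ∀ O' : (I × Fin D → Bool) → Bool, M.GivesState s O' → delay O ≤ delay O'

/-! ### Promise function problems and polynomial time -/

/-- A functional problem with a promise, together with encodings of its inputs and outputs
as words. -/
structure PromiseProblem where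
  Input : Type
  Promise : Input → Prop
  Output : Input → Type
  IsCorrect : ∀ P : Input, Output P → Prop
  InLetter : Type
  OutLetter : Type
  encodeInput : Input → List InLetter
  encodeOutput : ∀ P : Input, Output P → List OutLetter
  encodeInput_injective : Function.Injective encodeInput
  encodeOutput_injective : ∀ P, Function.Injective (encodeOutput P)

/-- The problem is in FP: a Turing machine running in polynomial time in the length of the
encoded input computes a correct output for each input that satisfies the promise. -/
def PromiseProblem.InFP (Q : PromiseProblem) : Prop :=
  ∃ f : ∀ P : {P : Q.Input // Q.Promise P}, Q.Output P.1,
    (∀ P, Q.IsCorrect P.1 (f P)) ∧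
      Nonempty (Turing.TM2ComputableInPolyTime (fun P => Q.encodeInput P.1)
        (id : List Q.OutLetter → List Q.OutLetter) (fun P => Q.encodeOutput P.1 (f P)))

/-! ### Words -/

/-- The alphabet. -/
inductive Letter : Type
  | tick
  | mark
  | close
  | node
  | input
  | not
  | and
  | or
  deriving DecidableEq

instance : Fintype Letter :=
  ⟨{.tick, .mark, .close, .node, .input, .not, .and, .or}, fun x => by cases x <;> decide⟩

/-- A number, in unary. (Every number written below is at most the number of objects which the
same word lists: automata, inputs, delays up to the number of automata, or nodes of a circuit.) -/
def encodeNum (k : ℕ) : List Letter :=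
  List.replicate k Letter.tick ++ [Letter.mark]

/-- A finite list, closed by a letter that no code of an element starts with. -/
def encodeList {α : Type} (e : α → List Letter) (l : List α) : List Letter :=
  l.flatMap e ++ [Letter.close]

/-- A node of a circuit, where `e` encodes the variables. -/
def encodeGate {A : Type} (e : A → List Letter) {N : ℕ} : Gate A (Fin N) → List Letter
  | Gate.var a => e a
  | Gate.not u => Letter.not :: encodeNum u
  | Gate.and us => Letter.and :: encodeList (fun u : Fin N => encodeNum u) us
  | Gate.or us => Letter.or :: encodeList (fun u : Fin N => encodeNum u) us

/-- A circuit: the list of its nodes, and its output node. -/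
def encodeCircuit {A : Type} (e : A → List Letter) (C : Circuit A) : List Letter :=
  encodeList (encodeGate e) (List.ofFn C.gate) ++ encodeNum C.output

/-- The variables of a local function: automata and inputs. -/
def encodeVar {n m : ℕ} : Fin n ⊕ Fin m → List Letter
  | Sum.inl s => Letter.node :: encodeNum s
  | Sum.inr α => Letter.input :: encodeNum α

/-- The variables of an output function: the input `α` with delay `d + 1`. -/
def encodeDelayedVar {m D : ℕ} : Fin m × Fin D → List Letter
  | (α, d) => Letter.input :: (encodeNum α ++ encodeNum (d + 1))

/-! ### The Output Circuit Computation Problem -/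

/-- An acyclic module with automata `Fin n` and inputs `Fin m`, encoded by the circuits of its
local functions, and a set `X` of output nodes. -/
structure ModuleInput where
  n : ℕ
  m : ℕ
  circuit : Fin n → Circuit (Fin n ⊕ Fin m)
  X : Finset (Fin n)
  acyclic : (BoolModule.mk fun s => (circuit s).eval).Acyclic

namespace ModuleInput

/-- The encoded module. -/
noncomputable def toModule (P : ModuleInput) : BoolModule (Fin P.n) (Fin P.m) :=
  ⟨fun s => (P.circuit s).eval⟩

/-- The output nodes, in increasing order. -/
def nodes (P : ModuleInput) : List (Fin P.n) :=
  (List.finRange P.n).filter (· ∈ P.X)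

theorem mem_nodes {P : ModuleInput} {s : Fin P.n} : s ∈ P.nodes ↔ s ∈ P.X := by
  simp [nodes]

/-- The numbers of automata and of inputs, the circuits of the local functions,
and the output nodes. -/
def encode (P : ModuleInput) : List Letter :=
  encodeNum P.n ++ encodeNum P.m ++
    (List.finRange P.n).flatMap (fun s => encodeCircuit encodeVar (P.circuit s)) ++
    encodeList (fun s : Fin P.n => encodeNum s) P.nodes

/-- An output: for each node in `X`, a circuit over the variables `α_1, …, α_n`, `α ∈ I`, where
`n` is the number of automata (no path of an acyclic interaction digraph has more nodes). -/
abbrev Output (P : ModuleInput) : Type :=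
  {s : Fin P.n // s ∈ P.X} → Circuit (Fin P.m × Fin P.n)

/-- The list of the pairs of a node in `X` and its circuit. -/
def encodeOutput (P : ModuleInput) (c : P.Output) : List Letter :=
  P.nodes.attach.flatMap fun s =>
    encodeNum s.1 ++
      encodeCircuit encodeDelayedVar (c ⟨s.1, mem_nodes.1 s.2⟩)

end ModuleInput

/-! ### Distinct objects have distinct codes -/

theorem encodeNum_append {a b : ℕ} {u v : List Letter}
    (h : encodeNum a ++ u = encodeNum b ++ v) : a = b ∧ u = v := by
  induction a generalizing b with
  | zero => cases b <;> simp_all [encodeNum, List.replicate_succ]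
  | succ a ih =>
    cases b with
    | zero => simp [encodeNum, List.replicate_succ] at h
    | succ b =>
      have := @ih b (by simpa [encodeNum, List.replicate_succ] using h)
      simp_all

theorem encodeList_append {α β γ : Type} {e : α → List Letter} {e' : β → List Letter}
    {r : α → γ} {r' : β → γ}
    (h : ∀ a b u v, e a ++ u = e' b ++ v → r a = r' b ∧ u = v)
    (hc : ∀ a u v, e a ++ u ≠ Letter.close :: v) (hc' : ∀ b u v, e' b ++ u ≠ Letter.close :: v)
    {l : List α} {l' : List β} {u v : List Letter}
    (hl : encodeList e l ++ u = encodeList e' l' ++ v) : l.map r = l'.map r' ∧ u = v := by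
  induction l generalizing l' with
  | nil =>
    cases l' with
    | nil => simpa [encodeList] using hl
    | cons b l' =>
      refine absurd hl.symm ?_
      simpa [encodeList] using hc' b _ u
  | cons a l ih =>
    cases l' with
    | nil =>
      refine absurd hl ?_
      simpa [encodeList] using hc a _ v
    | cons b l' =>
      obtain ⟨h₁, h₂⟩ := h a b (encodeList e l ++ u) (encodeList e' l' ++ v)
        (by simpa [encodeList] using hl)
      simp_all [ih h₂]

theorem encodeNum_ne_close {a : ℕ} {u v : List Letter} :
    encodeNum a ++ u ≠ Letter.close :: v := by
  cases a <;> simp [encodeNum, List.replicate_succ]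

theorem encodeNums_append {N N' : ℕ} {l : List (Fin N)} {l' : List (Fin N')} {u v : List Letter}
    (h : encodeList (fun u : Fin N => encodeNum u) l ++ u =
      encodeList (fun u : Fin N' => encodeNum u) l' ++ v) :
    l.map Fin.val = l'.map Fin.val ∧ u = v :=
  encodeList_append (fun _ _ _ _ h => encodeNum_append h) (fun _ _ _ => encodeNum_ne_close)
    (fun _ _ _ => encodeNum_ne_close) h

/-- A code of variables that `encodeGate` and `encodeList` can use. -/
structure IsVarCode {A : Type} (e : A → List Letter) : Prop where
  append : ∀ a b u v, e a ++ u = e b ++ v → a = b ∧ u = v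
  head : ∀ a, ∃ l, e a = Letter.node :: l ∨ e a = Letter.input :: l

theorem isVarCode_encodeVar {n m : ℕ} : IsVarCode (@encodeVar n m) where
  append a b u v h := by
    cases a <;> cases b <;> simp [encodeVar] at h <;> obtain ⟨h', rfl⟩ := encodeNum_append h <;>
      simpa [Fin.ext_iff] using h'
  head a := by cases a <;> simp [encodeVar]

theorem isVarCode_encodeDelayedVar {m D : ℕ} : IsVarCode (@encodeDelayedVar m D) where
  append a b u v h := by
    obtain ⟨a, d⟩ := a
    obtain ⟨b, d'⟩ := b
    simp only [encodeDelayedVar, List.cons_append, List.cons.injEq, true_and,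
      List.append_assoc] at h
    obtain ⟨h₁, h⟩ := encodeNum_append h
    obtain ⟨h₂, rfl⟩ := encodeNum_append h
    simpa [Fin.ext_iff] using And.intro h₁ (Nat.succ.inj h₂)
  head a := by simp [encodeDelayedVar]

/-- The gate with the numbers of its predecessors. -/
def Gate.toNat {A : Type} {N : ℕ} : Gate A (Fin N) → Gate A ℕ
  | Gate.var a => Gate.var a
  | Gate.not u => Gate.not u
  | Gate.and us => Gate.and (us.map Fin.val)
  | Gate.or us => Gate.or (us.map Fin.val)

theorem Gate.toNat_injective {A : Type} {N : ℕ} :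
    Function.Injective (@Gate.toNat A N) := by
  have hv := List.map_injective_iff.2 (Fin.val_injective (n := N))
  intro g g' h
  cases g <;> cases g' <;> simp [Gate.toNat, Fin.ext_iff] at h ⊢ <;> first | exact h | exact hv h

theorem encodeGate_append {A : Type} {e : A → List Letter} (he : IsVarCode e) {N N' : ℕ}
    (g : Gate A (Fin N)) (g' : Gate A (Fin N')) (u v : List Letter)
    (h : encodeGate e g ++ u = encodeGate e g' ++ v) : g.toNat = g'.toNat ∧ u = v := by
  cases g with
  | var a =>
    cases g' with
    | var b => simpa [Gate.toNat] using he.append a b u v h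
    | _ => obtain ⟨l, hl | hl⟩ := he.head a <;> simp [encodeGate, hl] at h
  | not w =>
    cases g' with
    | var b => obtain ⟨l, hl | hl⟩ := he.head b <;> simp [encodeGate, hl] at h
    | not w' =>
      simp only [encodeGate, List.cons_append, List.cons.injEq, true_and] at h
      simpa [Gate.toNat] using encodeNum_append h
    | _ => simp [encodeGate] at h
  | and us =>
    cases g' with
    | var b => obtain ⟨l, hl | hl⟩ := he.head b <;> simp [encodeGate, hl] at h
    | and us' =>
      simp only [encodeGate, List.cons_append, List.cons.injEq, true_and] at h
      simpa [Gate.toNat] using encodeNums_append h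
    | _ => simp [encodeGate] at h
  | or us =>
    cases g' with
    | var b => obtain ⟨l, hl | hl⟩ := he.head b <;> simp [encodeGate, hl] at h
    | or us' =>
      simp only [encodeGate, List.cons_append, List.cons.injEq, true_and] at h
      simpa [Gate.toNat] using encodeNums_append h
    | _ => simp [encodeGate] at h

theorem encodeGate_ne_close {A : Type} {e : A → List Letter} (he : IsVarCode e) {N : ℕ}
    (g : Gate A (Fin N)) (u v : List Letter) : encodeGate e g ++ u ≠ Letter.close :: v := by
  cases g with
  | var a => obtain ⟨l, hl | hl⟩ := he.head a <;> simp [encodeGate, hl]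
  | _ => simp [encodeGate]

theorem encodeCircuit_append {A : Type} {e : A → List Letter} (he : IsVarCode e)
    (C C' : Circuit A) (u v : List Letter)
    (h : encodeCircuit e C ++ u = encodeCircuit e C' ++ v) : C = C' ∧ u = v := by
  obtain ⟨N, g, o, _, _⟩ := C
  obtain ⟨N', g', o', _, _⟩ := C'
  simp only [encodeCircuit, List.append_assoc] at h
  obtain ⟨hg, h⟩ := encodeList_append (encodeGate_append he) (encodeGate_ne_close he)
    (encodeGate_ne_close he) h
  obtain ⟨ho, rfl⟩ := encodeNum_append h
  obtain rfl : N = N' := by simpa using congrArg List.length hg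
  obtain rfl : g = g' :=
    List.ofFn_injective (List.map_injective_iff.2 Gate.toNat_injective hg)
  obtain rfl : o = o' := Fin.ext ho
  exact ⟨rfl, rfl⟩

theorem flatMap_append_injective {α : Type} {l : List α} {β : Type} {e : β → List Letter}
    (he : ∀ a b u v, e a ++ u = e b ++ v → a = b ∧ u = v) {f g : α → β} {u v : List Letter}
    (h : l.flatMap (fun a => e (f a)) ++ u = l.flatMap (fun a => e (g a)) ++ v) :
    (∀ a ∈ l, f a = g a) ∧ u = v := by
  induction l with
  | nil => simpa using h
  | cons a l ih =>
    obtain ⟨h₁, h₂⟩ := he (f a) (g a) (l.flatMap (fun a => e (f a)) ++ u)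
      (l.flatMap (fun a => e (g a)) ++ v) (by simpa using h)
    simpa [h₁] using ih h₂

theorem ModuleInput.encode_injective : Function.Injective ModuleInput.encode := by
  rintro ⟨n, m, c, X, hP⟩ ⟨n', m', c', X', hP'⟩ h
  simp only [ModuleInput.encode, List.append_assoc] at h
  obtain ⟨rfl, h⟩ := encodeNum_append h
  obtain ⟨rfl, h⟩ := encodeNum_append h
  obtain ⟨hc, h⟩ := flatMap_append_injective (f := c) (g := c')
    (encodeCircuit_append isVarCode_encodeVar) h
  obtain rfl : c = c' := funext fun s => hc s (List.mem_finRange s)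
  have hX := List.map_injective_iff.2 Fin.val_injective
    (encodeNums_append (u := []) (v := []) (by simpa using h)).1
  obtain rfl : X = X' := by
    ext s
    have := congrArg (s ∈ ·) hX
    simpa [ModuleInput.nodes] using this
  rfl

theorem ModuleInput.encodeOutput_injective (P : ModuleInput) :
    Function.Injective P.encodeOutput := by
  intro c c' h
  have key := flatMap_append_injective
    (β := Fin P.n × Circuit (Fin P.m × Fin P.n)) (l := P.nodes.attach)
    (e := fun p => encodeNum p.1 ++ encodeCircuit encodeDelayedVar p.2)
    (f := fun s => (s.1, c ⟨s.1, ModuleInput.mem_nodes.1 s.2⟩))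
    (g := fun s => (s.1, c' ⟨s.1, ModuleInput.mem_nodes.1 s.2⟩)) (u := []) (v := [])
    (by
      rintro ⟨a, C⟩ ⟨b, C'⟩ u v h
      simp only [List.append_assoc] at h
      obtain ⟨h₁, h⟩ := encodeNum_append h
      obtain ⟨rfl, rfl⟩ := encodeCircuit_append isVarCode_encodeDelayedVar _ _ _ _ h
      simp [Fin.ext_iff, h₁])
    (by simpa [ModuleInput.encodeOutput] using h)
  funext s
  exact congrArg Prod.snd (key.1 ⟨s.1, ModuleInput.mem_nodes.2 s.2⟩ (List.mem_attach _ _))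

/-- The Output Circuit Computation Problem. Input: an acyclic module `M` and a set `X` of its
nodes. Promise: the encoding of the local functions of `M` only has essential variables.
Output: a circuit of the output function of each node in `X`. -/
noncomputable def outputCircuitComputation : PromiseProblem where
  Input := ModuleInput
  Promise P := ∀ s, (P.circuit s).OnlyEssential
  Output P := P.Output
  IsCorrect P c := ∀ s, P.toModule.IsOutputFunction s.1 (c s).eval
  InLetter := Letter
  OutLetter := Letter
  encodeInput := ModuleInput.encode
  encodeOutput P := P.encodeOutput
  encodeInput_injective := ModuleInput.encode_injective
  encodeOutput_injective P := P.encodeOutput_injective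

end AutomataNetwork

/-!
The output circuit of an automaton `s` is an unrolling of the module. For each delay `d` there is a
layer with a copy of the circuit of each automaton, in which an input `α` is read as `α_d`, and the
state of an automaton is read from the next layer, that of delay `d + 1`. Below `n` layers, where
`n` is the number of automata, any variable can stand for the initial states. The circuit then gives
the state of `s` after `n` updates from some configuration (`ModuleInput.eval_unrolled`). By
acyclicity, the number of ancestors in the interaction digraph is a rank that increases along the
arcs and is less than `n`, and after `k` updates the automata of rank less than `k` have forgotten
the initial configuration (`BoolModule.foldr_update_eq`). So the circuit gives the state of `s`
(`ModuleInput.givesState_unrolled`). Its delay is minimal because there is only one such function: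
a longer run is a shorter run from another configuration (`BoolModule.GivesState.unique`). The
promise is only needed for the existence of an input (`ModuleInput.m_pos`), as a circuit without
variables does not exist. All the output nodes share the same gates, and only the number of the
output changes: in each layer, the nodes which repeat the states come first, so that the output
for `s` is the node number `s`.

To see that the code of these circuits can be computed in polynomial time, let `PolyTime` be the
class of the functions of several words that a program fragment can write on a stack in polynomial
time while it preserves its arguments. It contains the constants and the variables, and it is closed
under concatenation, substitution (`PolyTime.bind`) and above all comprehension (`PolyTime.scan`):
if the word `g q a p r` is computed in polynomial time from a letter `a` of a word, the letters
before and after it, and the state `q` of a finite automaton that has read the letters before it,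
then so is the concatenation of these words over all the letters. A comprehension does not feed
results back, so that no size can explode and time bounds need not be computed by hand. A function
in this class is computed by a machine in polynomial time (`PolyTime.computableInPolyTime`).

The code of the unrolled circuits is a nest of four comprehensions: over the output nodes, the
delays, the circuits, and the letters of a circuit (`writeOutput`). With numbers in unary, the
renumbering of the nodes is only the concatenation of words, since the number of a node in a layer is
shifted by the number of the letters that start gates in the circuits before.
-/

namespace AutomataNetwork

/-! ### Structured programs over stacks -/

/-- A fragment of a multi-stack machine with stacks `K` over the alphabet `Γ`, in
continuation-passing style: given an embedding of its labels into those of a machine and the label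
at which the machine goes on, `code` is the statement of each label. The internal state only holds
the last letter read. -/
structure Prog (K Γ : Type) where
  Lab : Type
  [fin : Fintype Lab]
  entry : Lab
  code : ∀ {Λ : Type}, (Lab → Λ) → Λ → Lab →
    Turing.TM2.Stmt (fun _ : K => Γ) Λ (Option Γ)

attribute [instance] Prog.fin

namespace Prog

open Turing Turing.TM2 StateTransition

variable {K Γ : Type}

/-- Do nothing. -/
def skip : Prog K Γ where
  Lab := Unit
  entry := ()
  code _ exit _ := .goto fun _ => exit

/-- Push the letter `a` on the stack `k`. -/
def push (k : K) (a : Γ) : Prog K Γ where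
  Lab := Unit
  entry := ()
  code _ exit _ := .push k (fun _ => a) (.goto fun _ => exit)

/-- Run `c`, then `d`. -/
def seq (c d : Prog K Γ) : Prog K Γ where
  Lab := c.Lab ⊕ d.Lab
  entry := .inl c.entry
  code emb exit
    | .inl l => c.code (fun l => emb (.inl l)) (emb (.inr d.entry)) l
    | .inr l => d.code (fun l => emb (.inr l)) exit l

/-- Pop the letters of the stack `k` until it is empty. Meanwhile a finite automaton with
transitions `δ` reads these letters, and the program `c q a` is run when it reads `a` in
state `q`. -/
def loop [Fintype Γ] {σ : Type} [Fintype σ] (k : K) (δ : σ → Γ → σ) (c : σ → Γ → Prog K Γ)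
    (q : σ) : Prog K Γ where
  Lab := σ ⊕ Σ x : σ × Γ, (c x.1 x.2).Lab
  entry := .inl q
  code emb exit
    | .inl q => .pop k (fun _ o => o) (.goto fun
        | none => exit
        | some a => emb (.inr ⟨(q, a), (c q a).entry⟩))
    | .inr ⟨x, l⟩ => (c x.1 x.2).code (fun l => emb (.inr ⟨x, l⟩)) (emb (.inl (δ x.1 x.2))) l

variable [DecidableEq K]

/-- From the stacks `s`, the fragment `c` reaches its exit with the stacks `s'` in at most `t`
steps, in each machine that contains it. -/
def Runs (c : Prog K Γ) (s s' : K → List Γ) (t : ℕ) : Prop :=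
  ∀ (Λ : Type) (M : Λ → Stmt (fun _ : K => Γ) Λ (Option Γ)) (emb : c.Lab → Λ) (exit : Λ),
    (∀ l, M (emb l) = c.code emb exit l) → ∀ v, ∃ v',
      Nonempty (EvalsToInTime (step M) ⟨some (emb c.entry), v, s⟩ (some ⟨some exit, v', s'⟩) t)

theorem evalsToInTime_one {σ : Type} {f : σ → Option σ} {a : σ} {b : Option σ} (h : f a = b) :
    Nonempty (EvalsToInTime f a b 1) :=
  ⟨⟨⟨1, h⟩, le_rfl⟩⟩

theorem evalsToInTime_trans {σ : Type} {f : σ → Option σ} {a b : σ} {c : Option σ} {t t' : ℕ}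
    (h : Nonempty (EvalsToInTime f a (some b) t)) (h' : Nonempty (EvalsToInTime f b c t')) :
    Nonempty (EvalsToInTime f a c (t + t')) := by
  obtain ⟨h⟩ := h
  obtain ⟨h'⟩ := h'
  rw [add_comm]
  exact ⟨EvalsToInTime.trans _ _ _ _ _ _ h h'⟩

theorem step_entry {c : Prog K Γ} {Λ : Type} {M : Λ → Stmt (fun _ : K => Γ) Λ (Option Γ)}
    {emb : c.Lab → Λ} {exit : Λ} (hM : ∀ l, M (emb l) = c.code emb exit l) (v : Option Γ)
    (s : K → List Γ) :
    step M ⟨some (emb c.entry), v, s⟩ = some (stepAux (c.code emb exit c.entry) v s) := by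
  rw [step, hM]

theorem Runs.mono {c : Prog K Γ} {s s' : K → List Γ} {t t' : ℕ} (h : c.Runs s s' t)
    (ht : t ≤ t') : c.Runs s s' t' := fun Λ M emb exit hM v => by
  obtain ⟨v', ⟨h⟩⟩ := h Λ M emb exit hM v
  exact ⟨v', ⟨⟨h.toEvalsTo, h.steps_le_m.trans ht⟩⟩⟩

theorem runs_skip (s : K → List Γ) : skip.Runs s s 1 := fun _ _ _ _ hM v =>
  ⟨v, evalsToInTime_one (step_entry hM v s)⟩

theorem runs_push (k : K) (a : Γ) (s : K → List Γ) :
    (push k a).Runs s (Function.update s k (a :: s k)) 1 := fun _ _ _ _ hM v =>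
  ⟨v, evalsToInTime_one (step_entry hM v s)⟩

theorem Runs.seq {c d : Prog K Γ} {s s' s'' : K → List Γ} {t t' : ℕ} (h : c.Runs s s' t)
    (h' : d.Runs s' s'' t') : (c.seq d).Runs s s'' (t + t') := fun Λ M emb exit hM v => by
  obtain ⟨v', hv'⟩ := h Λ M (fun l => emb (.inl l)) (emb (.inr d.entry)) (fun l => hM (.inl l)) v
  obtain ⟨v'', hv''⟩ := h' Λ M (fun l => emb (.inr l)) exit (fun l => hM (.inr l)) v'
  exact ⟨v'', evalsToInTime_trans hv' hv''⟩

variable [Fintype Γ]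

variable {σ : Type} [Fintype σ]

theorem runs_loop_nil {k : K} (δ : σ → Γ → σ) (c : σ → Γ → Prog K Γ) (q : σ)
    {s : K → List Γ} (hk : s k = []) : (loop k δ c q).Runs s s 1 :=
  fun Λ M emb exit hM v =>
  ⟨none, evalsToInTime_one ((step_entry hM v s).trans
    (by simp only [loop, stepAux, hk, List.head?_nil, List.tail_nil]; rw [← hk]; simp))⟩

/-- The first turn of a loop: the letter `a` is popped, then the body runs, then the loop goes on
in the next state. -/
theorem runs_loop_cons {k : K} {δ : σ → Γ → σ} {c : σ → Γ → Prog K Γ} {q : σ} {a : Γ} {l : List Γ}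
    {s s' s'' : K → List Γ} {t t' : ℕ} (hk : s k = a :: l)
    (h : (c q a).Runs (Function.update s k l) s' t) (h' : (loop k δ c (δ q a)).Runs s' s'' t') :
    (loop k δ c q).Runs s s'' (1 + t + t') := fun Λ M emb exit hM v => by
  obtain ⟨v', hv'⟩ := h Λ M (fun l => emb (.inr ⟨(q, a), l⟩)) (emb (.inl (δ q a)))
    (fun l => hM (.inr ⟨(q, a), l⟩)) (some a)
  obtain ⟨v'', hv''⟩ := h' Λ M emb exit hM v'
  exact ⟨v'', evalsToInTime_trans (evalsToInTime_trans
    (evalsToInTime_one ((step_entry hM v s).trans (by simp [loop, hk]))) hv') hv''⟩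

/-- Move the letters of the stack `k` to the stack `k'`. -/
def move (k k' : K) : Prog K Γ :=
  loop k (fun _ _ => ()) (fun _ a => push k' a) ()

theorem runs_move {k k' : K} (hk : k ≠ k') (s : K → List Γ) :
    (move k k').Runs s (Function.update (Function.update s k []) k' ((s k).reverse ++ s k'))
      (2 * (s k).length + 1) := by
  induction hl : s k generalizing s with
  | nil =>
    have : Function.update (Function.update s k []) k' ([].reverse ++ s k') = s := by
      rw [← hl, Function.update_eq_self, hl]
      simp
    rw [this]
    exact @runs_loop_nil K Γ _ _ Unit _ k _ _ () s hl
  | cons a l ih =>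
    have h := runs_loop_cons (σ := Unit) (δ := fun _ _ => ()) (c := fun _ a => push k' a)
      (q := ()) hl (runs_push k' a _) (ih (Function.update (Function.update s k l) k' (a :: Function.update s k l k'))
        (by simp [hk]))
    refine (?_ : (move k k').Runs s _ _).mono (t := 1 + 1 + (2 * l.length + 1)) ?_
    · refine (congrArg (fun s' => (move k k').Runs s s' _) ?_).mp h
      funext j
      by_cases hj : j = k' <;> by_cases hj' : j = k <;> simp [hj, hj', hk, hk.symm]
    · simp; omega

/-- Empty the stack `k`. -/
def clear (k : K) : Prog K Γ :=
  loop k (fun _ _ => ()) (fun _ _ => skip) ()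

theorem runs_clear (k : K) (s : K → List Γ) :
    (clear k).Runs s (Function.update s k []) (2 * (s k).length + 1) := by
  induction hl : s k generalizing s with
  | nil =>
    have : Function.update s k [] = s := by simp [hl, Function.update_eq_self_iff]
    rw [this]
    exact @runs_loop_nil K Γ _ _ Unit _ k _ _ () s hl
  | cons a l ih =>
    have h := runs_loop_cons (σ := Unit) (δ := fun _ _ => ()) (c := fun _ _ => skip) (q := ()) hl
      (runs_skip _) (ih (Function.update s k l) (by simp))
    rw [Function.update_idem] at h
    exact (show (clear k).Runs s _ _ from h).mono (by simp; omega)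

end Prog

/-! ### Polynomial-time functions of several words -/

/-- The words `g q a p r` for each letter `a` of a word, in order, where `q` is the state of a finite
automaton with transitions `δ` when it reads this letter, `p` is the reversed word of the letters
before it and `r` is the word of the letters after it. The arguments are the current state, the
reversed word of the letters which have been read, and the remaining letters. -/
def scan {σ Γ : Type} (δ : σ → Γ → σ) (g : σ → Γ → List Γ → List Γ → List Γ) :
    σ → List Γ → List Γ → List Γ
  | _, _, [] => []
  | q, p, a :: r => g q a p r ++ scan δ g (δ q a) (a :: p) r

variable {K Γ : Type}

/-- The program `c` writes `f v` on the stack `out`, its first letter first, where the words `v`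
are on the stacks `ρ`. The stacks `scr`, which `c` uses, have to be empty before, and `c` modifies
no stack but `out` in the end. The number of steps is at most `p` of the length of the longest of
the words `v`. -/
def Writes [DecidableEq K] {n : ℕ} {C : Type} (p : Polynomial ℕ)
    (f : (Fin n → List Γ) → List Γ) (ρ : Fin n → K) (out : K) (scr : C → K) (c : Prog K Γ) : Prop :=
  ∀ (s : K → List Γ) (N : ℕ), (∀ x, s (scr x) = []) → (∀ i, (s (ρ i)).length ≤ N) →
    c.Runs s (Function.update s out ((f fun i => s (ρ i)).reverse ++ s out)) (p.eval N)

/-- The function `f` of `n` words can be computed in polynomial time, by a program fragment which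
needs finitely many auxiliary stacks and can be placed in any machine that has them. -/
def PolyTime {n : ℕ} (f : (Fin n → List Γ) → List Γ) : Prop :=
  ∃ (C : Type) (_ : Fintype C) (p : Polynomial ℕ),
    (∀ (v : Fin n → List Γ) (N : ℕ), (∀ i, (v i).length ≤ N) → (f v).length ≤ p.eval N) ∧
    ∀ (K : Type) [DecidableEq K] (ρ : Fin n → K) (out : K) (scr : C → K),
      Function.Injective scr → (∀ i, ρ i ≠ out) → (∀ x, scr x ≠ out) → (∀ i x, ρ i ≠ scr x) →
      ∃ c : Prog K Γ, Writes p f ρ out scr c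

namespace PolyTime

variable {n : ℕ}

theorem nil : PolyTime fun _ : Fin n → List Γ => ([] : List Γ) :=
  ⟨Empty, inferInstance, 1, by simp, fun K _ ρ out scr _ _ _ _ => ⟨Prog.skip, fun s N _ _ => by
    simpa using Prog.runs_skip s⟩⟩

theorem singleton (a : Γ) : PolyTime fun _ : Fin n → List Γ => [a] :=
  ⟨Empty, inferInstance, 1, by simp, fun K _ ρ out scr _ _ _ _ =>
    ⟨Prog.push out a, fun s N _ _ => by simpa using Prog.runs_push out a s⟩⟩

theorem append {f g : (Fin n → List Γ) → List Γ} (hf : PolyTime f) (hg : PolyTime g) :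
    PolyTime fun v => f v ++ g v := by
  obtain ⟨C, _, p, hp, hf⟩ := hf
  obtain ⟨D, _, q, hq, hg⟩ := hg
  refine ⟨C ⊕ D, inferInstance, p + q, fun v N hv => ?_, fun K _ ρ out scr h₁ h₂ h₃ h₄ => ?_⟩
  · simpa using add_le_add (hp v N hv) (hq v N hv)
  · obtain ⟨c, hc⟩ := hf K ρ out (fun x => scr (.inl x)) (h₁.comp Sum.inl_injective) h₂
      (fun x => h₃ _) (fun i x => h₄ i _)
    obtain ⟨d, hd⟩ := hg K ρ out (fun x => scr (.inr x)) (h₁.comp Sum.inr_injective) h₂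
      (fun x => h₃ _) (fun i x => h₄ i _)
    refine ⟨c.seq d, fun s N hs hN => ?_⟩
    have := (hc s N (fun x => hs _) hN).seq (hd _ N (fun x => by simp [h₃, hs])
      (fun i => by simpa [h₂] using hN i))
    simpa [h₂] using this

theorem const (l : List Γ) : PolyTime fun _ : Fin n → List Γ => l := by
  induction l with
  | nil => exact nil
  | cons a l ih => exact (singleton a).append ih

theorem rename {m : ℕ} {f : (Fin m → List Γ) → List Γ} (hf : PolyTime f) (e : Fin m → Fin n) :
    PolyTime fun v : Fin n → List Γ => f fun i => v (e i) := by
  obtain ⟨C, _, p, hp, hf⟩ := hf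
  refine ⟨C, inferInstance, p, fun v N hv => hp _ N fun i => hv _,
    fun K _ ρ out scr h₁ h₂ h₃ h₄ => ?_⟩
  obtain ⟨c, hc⟩ := hf K (fun i => ρ (e i)) out scr h₁ (fun i => h₂ _) h₃ (fun i x => h₄ _ x)
  exact ⟨c, fun s N hs hN => hc s N hs fun i => hN _⟩

theorem vecCons_stacks {s : K → List Γ} {k : K} {ρ : Fin n → K} :
    (fun i => s (Matrix.vecCons k ρ i)) = Matrix.vecCons (s k) fun i => s (ρ i) :=
  funext fun i => Fin.cases rfl (fun _ => rfl) i

variable [Fintype Γ]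

theorem var (i : Fin n) : PolyTime fun v : Fin n → List Γ => v i := by
  refine ⟨Unit, inferInstance, 5 * Polynomial.X + 2, fun v N hv => ?_,
    fun K _ ρ out scr _ h₂ h₃ h₄ => ?_⟩
  · have := hv i
    simp
    omega
  generalize hx : ρ i = x
  generalize hy : scr () = y
  have hxy : x ≠ y := hx ▸ hy ▸ h₄ i ()
  have hxo : x ≠ out := hx ▸ h₂ i
  have hyo : y ≠ out := hy ▸ h₃ ()
  let copy : Prog K Γ :=
    Prog.loop x (fun _ _ => ()) (fun _ a => (Prog.push y a).seq (Prog.push out a)) ()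
  have hcopy : ∀ (l : List Γ) (s : K → List Γ), s x = l → copy.Runs s (Function.update
      (Function.update (Function.update s x []) y (l.reverse ++ s y)) out (l.reverse ++ s out))
      (3 * l.length + 1) := by
    intro l
    induction l with
    | nil =>
      intro s hs
      have : Function.update (Function.update (Function.update s x []) y ([].reverse ++ s y)) out
          ([].reverse ++ s out) = s := by
        rw [← hs, Function.update_eq_self, hs]
        simp
      rw [this]
      exact @Prog.runs_loop_nil K Γ _ _ Unit _ x _ _ () s hs
    | cons a l ih =>
      intro s hs
      have h := Prog.runs_loop_cons (σ := Unit) (δ := fun _ _ => ())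
        (c := fun _ a => (Prog.push y a).seq (Prog.push out a)) (q := ()) hs
        ((Prog.runs_push y a _).seq (Prog.runs_push out a _)) (ih _ (by simp [hxy, hxo]))
      refine (?_ : copy.Runs s _ _).mono (t := 1 + (1 + 1) + (3 * l.length + 1)) ?_
      · refine (congrArg (fun s' => copy.Runs s s' _) ?_).mp h
        funext j
        by_cases h₁ : j = x <;> by_cases h₂ : j = y <;> by_cases h₃ : j = out <;>
          simp_all [Ne.symm]
      · simp
        omega
  refine ⟨copy.seq (Prog.move y x), fun s N hs hN => ?_⟩
  have h := (hcopy (s x) s rfl).seq (Prog.runs_move hxy.symm _)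
  have hy' : s y = [] := hy ▸ hs ()
  refine (?_ : Prog.Runs _ _ _ _).mono (t := (3 * (s x).length + 1) + (2 * (s x).length + 1)) ?_
  · simp only [Function.update_of_ne hyo, Function.update_self, hy', List.append_nil,
      List.length_reverse] at h
    refine (congrArg (fun s' => Prog.Runs _ s s' _) ?_).mp h
    funext j
    by_cases h₁ : j = x <;> by_cases h₂ : j = y <;> by_cases h₃ : j = out <;>
      simp_all [Ne.symm]
  · have := hN i
    simp [hx] at *
    omega

/-- Substitution of a computed word for the first variable. -/
theorem bind {f : (Fin (n + 1) → List Γ) → List Γ} {h : (Fin n → List Γ) → List Γ}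
    (hf : PolyTime f) (hh : PolyTime h) : PolyTime fun v => f (Matrix.vecCons (h v) v) := by
  obtain ⟨C, _, p, hp, hf⟩ := hf
  obtain ⟨D, _, q, hq, hh⟩ := hh
  have bound : ∀ (v : Fin n → List Γ) (N : ℕ), (∀ i, (v i).length ≤ N) →
      ∀ i, (Matrix.vecCons (h v) v i).length ≤ N + q.eval N := fun v N hv i =>
    Fin.cases ((hq v N hv).trans (by simp)) (fun i => (hv i).trans (by simp)) i
  refine ⟨(C ⊕ D) ⊕ Bool, inferInstance, q + (2 * q + 1) + p.comp (Polynomial.X + q) + (2 * q + 1),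
    fun v N hv => ?_, fun K _ ρ out scr h₁ h₂ h₃ h₄ => ?_⟩
  · have := hp _ _ (bound v N hv)
    simp
    omega
  · have hAB : scr (.inr true) ≠ scr (.inr false) := h₁.ne (by simp)
    obtain ⟨c, hc⟩ := hf K (Matrix.vecCons (scr (.inr false)) ρ) out (fun x => scr (.inl (.inl x)))
      (h₁.comp (Sum.inl_injective.comp Sum.inl_injective))
      (fun i => Fin.cases (h₃ _) h₂ i) (fun x => h₃ _)
      (fun i x => Fin.cases (h₁.ne (by simp)) (fun i => h₄ i _) i)
    obtain ⟨d, hd⟩ := hh K ρ (scr (.inr true)) (fun x => scr (.inl (.inr x)))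
      (h₁.comp (Sum.inl_injective.comp Sum.inr_injective))
      (fun i => h₄ i _) (fun x => h₁.ne (by simp)) (fun i x => h₄ i _)
    refine ⟨((d.seq (Prog.move (scr (.inr true)) (scr (.inr false)))).seq c).seq
      (Prog.clear (scr (.inr false))), fun s N hs hN => ?_⟩
    set v := fun i => s (ρ i)
    have key := (hd s N (fun x => hs _) hN).seq (Prog.runs_move hAB _)
    simp only [Function.update_self, Function.update_idem, hs, Function.update_of_ne hAB.symm,
      List.append_nil, List.reverse_reverse] at key
    rw [(Function.update_eq_self_iff (f := s)).2 (hs (.inr true)).symm] at key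
    have hs' : (fun i => Function.update s (scr (.inr false)) (h v)
        (Matrix.vecCons (scr (.inr false)) ρ i)) = Matrix.vecCons (h v) v := by
      rw [vecCons_stacks, Function.update_self]
      simp [h₄, v]
    have key' := (key.seq (hc _ (N + q.eval N) (fun x => ?_) fun i => ?_)).seq
      (Prog.runs_clear (scr (.inr false)) _)
    · rw [hs'] at key'
      simp only [Function.update_of_ne (h₃ _), Function.update_self,
        Function.update_of_ne (h₃ _).symm] at key'
      refine Prog.Runs.mono ((congrArg (fun s' => Prog.Runs _ s s' _) ?_).mp key') ?_
      · have hB := h₃ (.inr false)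
        have hB' := hs (.inr false)
        generalize scr (.inr false) = B at hB hB' ⊢
        funext j
        by_cases hj : j = B
        · subst hj
          simp [hB, hB']
        · by_cases hj' : j = out
          · subst hj'
            simp [hj, v]
          · simp [hj, hj']
      · have : (h fun i => s (ρ i)).length ≤ q.eval N := hq _ N hN
        simp
        omega
    · rw [Function.update_of_ne (h₁.ne (by simp))]
      exact hs _
    · rw [congrFun hs' i]
      exact bound v N hN i

/-- The words of `scan` can be computed in polynomial time when each of them can be computed from
the letters before, the letters after and the other variables. -/
theorem scan_var {σ : Type} [Fintype σ] (δ : σ → Γ → σ)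
    {g : σ → Γ → List Γ → List Γ → (Fin n → List Γ) → List Γ}
    (hg : ∀ q a, PolyTime fun v : Fin (n + 2) → List Γ => g q a (v 0) (v 1) fun i => v i.succ.succ)
    (i : Fin n) (q : σ) : PolyTime fun v => scan δ (fun q a p r => g q a p r v) q [] (v i) := by
  choose C hC P hP hg using hg
  obtain ⟨D, _, Q, hQ, hx⟩ := var (Γ := Γ) i
  set S := ∑ q, ∑ a, P q a
  have le : ∀ q a N, (P q a).eval N ≤ S.eval N := fun q a N => by
    simp only [S, Polynomial.eval_finsetSum]
    exact (Finset.single_le_sum (f := fun a => (P q a).eval N) (by simp) (Finset.mem_univ a)).trans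
      (Finset.single_le_sum (f := fun q => ∑ a, (P q a).eval N) (by simp) (Finset.mem_univ q))
  have bound : ∀ (v : Fin n → List Γ) (N : ℕ) (p r : List Γ), (∀ i, (v i).length ≤ N) →
      p.length + r.length ≤ N →
      ∀ i, (Matrix.vecCons p (Matrix.vecCons r v) i).length ≤ N := fun v N p r hv hpr i => by
    refine Fin.cases ?_ (fun i => Fin.cases ?_ (fun i => hv i) i) i
    · exact (Nat.le_add_right _ _).trans hpr
    · exact (Nat.le_add_left _ _).trans hpr
  have scan_le : ∀ (v : Fin n → List Γ) (N : ℕ), (∀ i, (v i).length ≤ N) →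
      ∀ (r : List Γ) (q : σ) (p : List Γ), p.length + r.length ≤ N →
      (scan δ (fun q a p r => g q a p r v) q p r).length ≤ r.length * S.eval N := by
    intro v N hv r
    induction r with
    | nil => simp [scan]
    | cons a r ih =>
      intro q p hpr
      simp only [List.length_cons] at hpr
      have h₁ := (hP q a _ N (bound v N p r hv (by omega))).trans (le q a N)
      have h₂ := ih (δ q a) (a :: p) (by simp; omega)
      simp only [scan, List.length_append, List.length_cons, add_mul, one_mul]
      rw [add_comm]
      exact add_le_add h₂ h₁
  refine ⟨((Σ x : σ × Γ, C x.1 x.2) ⊕ D) ⊕ Fin 3, inferInstance,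
    Q + (2 * Polynomial.X + 1) + (Polynomial.X * (S + 2) + 1) + (2 * Polynomial.X + 1), fun v N hv => ?_,
    fun K _ ρ out scr h₁ h₂ h₃ h₄ => ?_⟩
  · refine (scan_le v N hv (v i) q [] (by simpa using hv i)).trans ?_
    have := Nat.mul_le_mul_right (S.eval N) (hv i)
    simp [mul_add]
    omega
  obtain ⟨d, hd⟩ := hx K ρ (scr (.inr 0)) (fun x => scr (.inl (.inr x)))
    (h₁.comp (Sum.inl_injective.comp Sum.inr_injective))
    (fun i => h₄ i _) (fun x => h₁.ne (by simp)) (fun i x => h₄ i _)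
  have := fun q a => hg q a K (Matrix.vecCons (scr (.inr 1)) (Matrix.vecCons (scr (.inr 2)) ρ)) out
    (fun x => scr (.inl (.inl ⟨(q, a), x⟩)))
    (h₁.comp (Sum.inl_injective.comp (Sum.inl_injective.comp sigma_mk_injective)))
    (fun i => Fin.cases (h₃ _) (fun i => Fin.cases (h₃ _) h₂ i) i) (fun x => h₃ _)
    (fun i x => Fin.cases (h₁.ne (by simp))
      (fun i => Fin.cases (h₁.ne (by simp)) (fun i => h₄ i _) i) i)
  choose c hc using this
  have h01 : scr (.inr 0) ≠ scr (.inr 2) := h₁.ne (by simp)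
  have h12 : scr (.inr 1) ≠ scr (.inr 2) := h₁.ne (by simp)
  have hA := h₃ (.inr 0)
  have hp := h₃ (.inr 1)
  have hr := h₃ (.inr 2)
  have hρp : ∀ i, ρ i ≠ scr (.inr 1) := fun i => h₄ i _
  have hρr : ∀ i, ρ i ≠ scr (.inr 2) := fun i => h₄ i _
  have hsp : ∀ q a x, scr (.inl (.inl ⟨(q, a), x⟩)) ≠ scr (.inr 1) := fun q a x => h₁.ne (by simp)
  have hsr : ∀ q a x, scr (.inl (.inl ⟨(q, a), x⟩)) ≠ scr (.inr 2) := fun q a x => h₁.ne (by simp)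
  have hso : ∀ q a x, scr (.inl (.inl ⟨(q, a), x⟩)) ≠ out := fun q a x => h₃ _
  have hs0 : ∀ s : K → List Γ, (∀ x, s (scr x) = []) →
      s (scr (.inr 0)) = [] ∧ s (scr (.inr 1)) = [] ∧ s (scr (.inr 2)) = [] :=
    fun s hs => ⟨hs _, hs _, hs _⟩
  have h00 : ∀ q a x, scr (.inl (.inl ⟨(q, a), x⟩)) ≠ scr (.inr 0) := fun q a x => h₁.ne (by simp)
  have hρ0 : ∀ i, ρ i ≠ scr (.inr 0) := fun i => h₄ i _
  generalize scr (.inr 0) = kx at *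
  generalize scr (.inr 1) = kp at *
  generalize scr (.inr 2) = kr at *
  let body : σ → Prog K Γ := Prog.loop kr δ fun q a => (c q a).seq (Prog.push kp a)
  have hbody : ∀ (v : Fin n → List Γ) (N : ℕ), (∀ i, (v i).length ≤ N) →
      ∀ (r : List Γ) (q : σ) (s : K → List Γ), s kr = r → (∀ i, s (ρ i) = v i) →
      (∀ q a x, s (scr (.inl (.inl ⟨(q, a), x⟩))) = []) → (s kp).length + r.length ≤ N →
      (body q).Runs s (Function.update (Function.update (Function.update s kr []) kp
        (r.reverse ++ s kp)) out
          ((scan δ (fun q a p r => g q a p r v) q (s kp) r).reverse ++ s out))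
        (r.length * (S.eval N + 2) + 1) := by
    intro v N hv r
    induction r with
    | nil =>
      intro q s hs _ _ _
      have : Function.update (Function.update (Function.update s kr []) kp
          ([].reverse ++ s kp)) out ((scan δ (fun q a p r => g q a p r v) q (s kp) []).reverse
            ++ s out) = s := by
        rw [← hs, Function.update_eq_self, hs]
        simp [scan]
      rw [this]
      exact (Prog.runs_loop_nil δ _ q hs).mono (by simp)
    | cons a r ih =>
      intro q s hs hsv hss hpr
      simp only [List.length_cons] at hpr
      have hv' : (fun i => Function.update s kr r
          (Matrix.vecCons kp (Matrix.vecCons kr ρ) i)) =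
          Matrix.vecCons (s kp) (Matrix.vecCons r v) := by
        rw [vecCons_stacks, vecCons_stacks]
        simp [h12, hρr, hsv]
      have h := (hc q a (Function.update s kr r) N (fun x => by simp [hsr, hss]) (fun i => by
        rw [congrFun hv' i]
        exact bound v N _ r hv (by omega) i)).seq (Prog.runs_push kp a _)
      rw [hv'] at h
      have h' := Prog.runs_loop_cons hs h (ih (δ q a) _ (by simp [h12.symm, hr])
        (fun i => by simp [hρp, h₂, hρr, hsv]) (fun q a x => by simp [hsp, hso, hsr, hss])
        (by simp [hp, h12]; omega))
      refine Prog.Runs.mono ((congrArg (fun s' => Prog.Runs _ s s' _) ?_).mp h') ?_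
      · funext j
        by_cases hj₁ : j = out
        · subst hj₁
          simp [hp, hp.symm, hr.symm, h12, scan, Matrix.vecCons]
        · by_cases hj₂ : j = kp
          · subst hj₂
            simp [hj₁, h12]
          · by_cases hj₃ : j = kr
            · subst hj₃
              simp [hj₁, hj₂]
            · simp [hj₁, hj₂, hj₃]
      · have := le q a N
        simp only [List.length_cons, add_mul, one_mul]
        omega
  refine ⟨((d.seq (Prog.move kx kr)).seq (body q)).seq (Prog.clear kp),
    fun s N hs hN => ?_⟩
  obtain ⟨hx0, hp0, hr0⟩ := hs0 s hs
  have h := (hd s N (fun x => hs _) hN).seq (Prog.runs_move h01 _)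
  simp only [Function.update_self, Function.update_idem, hx0, Function.update_of_ne h01.symm,
    List.append_nil, List.reverse_reverse, hr0, List.length_reverse] at h
  rw [(Function.update_eq_self_iff (f := s)).2 hx0.symm] at h
  have h' := (h.seq (hbody (fun i => s (ρ i)) N hN (s (ρ i)) q _ (by simp)
    (fun i => by simp [hρr]) (fun q a x => by simp [hsr, hs])
    (by simpa [h12, hp0] using hN i))).seq (Prog.runs_clear kp _)
  refine Prog.Runs.mono ((congrArg (fun s' => Prog.Runs _ s s' _) ?_).mp h') ?_
  · funext j
    by_cases hj₁ : j = out
    · subst hj₁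
      simp [hp.symm, hr.symm, h12, hp0]
    · by_cases hj₂ : j = kp
      · subst hj₂
        simp [hj₁, hp0]
      · by_cases hj₃ : j = kr
        · subst hj₃
          simp [hj₁, hj₂, hr0]
        · simp [hj₁, hj₂, hj₃]
  · have := Nat.mul_le_mul_right (S.eval N + 2) (hN i)
    have := hN i
    simp [hp, h12, hp0]
    omega

theorem scan {σ : Type} [Fintype σ] (δ : σ → Γ → σ)
    {g : σ → Γ → List Γ → List Γ → (Fin n → List Γ) → List Γ}
    (hg : ∀ q a, PolyTime fun v : Fin (n + 2) → List Γ => g q a (v 0) (v 1) fun i => v i.succ.succ)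
    {x : (Fin n → List Γ) → List Γ} (hx : PolyTime x) (q : σ) :
    PolyTime fun v => AutomataNetwork.scan δ (fun q a p r => g q a p r v) q [] (x v) :=
  bind (f := fun v => AutomataNetwork.scan δ (fun q a p r => g q a p r fun i => v i.succ) q [] (v 0))
    (scan_var δ (g := fun q a p r v => g q a p r fun i => v i.succ) (fun q a =>
      (hg q a).rename (Fin.cases 0 (Fin.cases 1 fun i => i.succ.succ.succ))) 0 q) hx

end PolyTime

/-! ### Machines for polynomial-time functions -/

open Turing in
/-- The machine that runs `c` and then halts, with input stack `k₀` and output stack `k₁`. -/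
def Prog.machine {K Γ : Type} [DecidableEq K] [Fintype K] [Fintype Γ] (c : Prog K Γ) (k₀ k₁ : K) :
    FinTM2 where
  K := K
  k₀ := k₀
  k₁ := k₁
  Γ _ := Γ
  Λ := Option c.Lab
  main := some c.entry
  σ := Option Γ
  initialState := none
  Γk₀Fin := inferInstance
  m
    | some l => c.code some none l
    | none => .load (fun _ => none) .halt

theorem Prog.Runs.outputs {K Γ : Type} [DecidableEq K] [Fintype K] [Fintype Γ] {c : Prog K Γ}
    {k₀ k₁ : K} {u v : List Γ} {t : ℕ}
    (h : c.Runs (Function.update (fun _ => []) k₀ u) (Function.update (fun _ => []) k₁ v) t) :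
    Nonempty (Turing.TM2OutputsInTime (c.machine k₀ k₁) u (some v) (t + 1)) := by
  obtain ⟨v', h⟩ := h (Option c.Lab) (c.machine k₀ k₁).m some none (fun _ => rfl) none
  have h' := evalsToInTime_trans h (evalsToInTime_one rfl)
  have e₀ : Turing.initList (c.machine k₀ k₁) u =
      ⟨some (some c.entry), none, Function.update (fun _ => []) k₀ u⟩ := by
    refine congrArg (Turing.TM2.Cfg.mk _ _) (funext (α := K) fun k => ?_)
    rcases eq_or_ne k₀ k with rfl | hk
    · refine (dif_pos rfl).trans ?_
      change u = Function.update (fun _ : K => ([] : List Γ)) k₀ u k₀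
      rw [Function.update_self]
    · refine (dif_neg hk.symm).trans ?_
      change [] = Function.update (fun _ : K => ([] : List Γ)) k₀ u k
      rw [Function.update_of_ne hk.symm]
  have e₁ : Turing.haltList (c.machine k₀ k₁) v =
      ⟨none, none, Function.update (fun _ => []) k₁ v⟩ := by
    refine congrArg (Turing.TM2.Cfg.mk _ _) (funext (α := K) fun k => ?_)
    rcases eq_or_ne k₁ k with rfl | hk
    · refine (dif_pos rfl).trans ?_
      change v = Function.update (fun _ : K => ([] : List Γ)) k₁ v k₁
      rw [Function.update_self]
    · refine (dif_neg hk.symm).trans ?_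
      change [] = Function.update (fun _ : K => ([] : List Γ)) k₁ v k
      rw [Function.update_of_ne hk.symm]
  have e₂ : Option.map (Turing.haltList (c.machine k₀ k₁)) (some v) =
      some ⟨none, none, Function.update (fun _ => []) k₁ v⟩ := congrArg some e₁
  unfold Turing.TM2OutputsInTime
  rw [e₀, e₂]
  exact h'

/-- A function which is computed in polynomial time by a program fragment is computed in polynomial
time by a machine. -/
theorem PolyTime.computableInPolyTime {Γ α : Type} [Fintype Γ]
    {f : (Fin 1 → List Γ) → List Γ} (hf : PolyTime f) {e g : α → List Γ}
    (h : ∀ a, f (fun _ => e a) = g a) :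
    Nonempty (Turing.TM2ComputableInPolyTime e (id : List Γ → List Γ) g) := by
  classical
  obtain ⟨C, _, p, hp, hf⟩ := hf
  obtain ⟨c, hc⟩ := hf (Fin 3 ⊕ C) (fun _ => .inl 0) (.inl 1) .inr Sum.inr_injective
    (by simp) (by simp) (by simp)
  -- The output is written in reverse on an auxiliary stack, then moved to the output stack.
  let d : Prog (Fin 3 ⊕ C) Γ := (c.seq (Prog.clear (.inl 0))).seq (Prog.move (.inl 1) (.inl 2))
  have hd : ∀ u, d.Runs (Function.update (fun _ => []) (.inl 0) u)
      (Function.update (fun _ => []) (.inl 2) (f fun _ => u))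
      (p.eval u.length + (2 * u.length + 1) + (2 * p.eval u.length + 1)) := fun u => by
    have := ((hc (Function.update (fun _ => []) (.inl 0) u) u.length (by simp) (by simp)).seq
      (Prog.runs_clear (.inl 0) _)).seq (Prog.runs_move (k := .inl 1) (k' := .inl 2) (by simp) _)
    refine Prog.Runs.mono ((congrArg (fun s' => Prog.Runs _ _ s' _) ?_).mp this) ?_
    · funext j
      rcases j with j | j
      · fin_cases j <;> simp
      · simp
    · have := hp (fun _ => u) u.length (by simp)
      simp
      omega
  have hout := fun a => (hd (e a)).outputs
  refine ⟨{ tm := d.machine (.inl 0) (.inl 2)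
            inputAlphabet := Equiv.refl Γ
            outputAlphabet := Equiv.refl Γ
            time := p + (2 * Polynomial.X + 1) + (2 * p + 1) + 1
            outputsFun := fun a => ?_ }⟩
  have ht : (p + (2 * Polynomial.X + 1) + (2 * p + 1) + 1).eval (e a).length =
      p.eval (e a).length + (2 * (e a).length + 1) + (2 * p.eval (e a).length + 1) + 1 := by simp
  have h₁ : List.map (Equiv.refl Γ).invFun (e a) = e a := List.map_id _
  have h₂ : List.map (Equiv.refl Γ).invFun (id (g a)) = f fun _ => e a :=
    (List.map_id _).trans (h a).symm
  rw [ht]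
  exact (congrArg₂ (fun x y => Turing.TM2OutputsInTime (d.machine (.inl 0) (.inl 2)) x (some y) _)
    h₁ h₂).mpr (hout a).some

/-! ### Influence, ranks, and uniqueness of the output function -/

/-- A function only depends on the variables that influence it. -/
theorem eq_of_forall_influences {A : Type} [Finite A] {f : (A → Bool) → Bool} {x x' : A → Bool}
    (h : ∀ a, Influences f a → x a = x' a) : f x = f x' := by
  classical
  have := Fintype.ofFinite A
  -- The variables of `s` are changed one at a time.
  have key : ∀ (s : Finset A) (x : A → Bool), (∀ a ∉ s, x a = x' a) →
      (∀ a, Influences f a → x a = x' a) → f x = f x' := by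
    intro s
    induction s using Finset.induction_on with
    | empty => exact fun x hx _ => congrArg f (funext fun a => hx a (by simp))
    | insert a s ha ih =>
      intro x hx h
      by_cases hxa : x a = x' a
      · refine ih x (fun b hb => ?_) h
        by_cases hba : b = a
        · rw [hba, hxa]
        · exact hx b (by simp [hba, hb])
      · rw [← ih (Function.update x a (x' a)) (fun b hb => ?_) fun b hb => ?_]
        · by_contra hne
          refine hxa (h a ⟨x, Function.update x a (x' a), fun b => ⟨fun hba => by simp [hba], ?_⟩,
            hne⟩)
          rintro hb rfl
          simp [hxa] at hb
        · by_cases hba : b = a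
          · simp [hba]
          · rw [Function.update_of_ne hba]
            exact hx b (by simp [hba, hb])
        · by_cases hba : b = a
          · simp [hba]
          · rw [Function.update_of_ne hba]
            exact h b hb
  exact key Finset.univ x (by simp) h

/-- In a finite cycle-free digraph, the number of ancestors of a node increases along the arcs. -/
theorem CycleFree.exists_rank {V : Type} [Fintype V] {arc : V → V → Prop} (h : CycleFree arc) :
    ∃ r : V → ℕ, (∀ u v, arc u v → r u < r v) ∧ ∀ v, r v < Fintype.card V := by
  classical
  refine ⟨fun v => (Finset.univ.filter fun u => Relation.TransGen arc u v).card,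
    fun u v huv => Finset.card_lt_card ?_, fun v => ?_⟩
  · refine Finset.ssubset_iff_of_subset (fun w hw => ?_) |>.2 ⟨u, by simpa using .single huv, ?_⟩
    · simp only [Finset.mem_filter, Finset.mem_univ, true_and] at hw ⊢
      exact hw.tail huv
    · simpa using h u
  · exact Finset.card_lt_univ_of_notMem (x := v) (by simpa using h v)

theorem cycleFree_of_rank {V β : Type} [Preorder β] {arc : V → V → Prop} (r : V → β)
    (h : ∀ u v, arc u v → r u < r v) : CycleFree arc := fun v hv => by
  have : ∀ u w, Relation.TransGen arc u w → r u < r w := fun u w hu => by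
    induction hu with
    | single h' => exact h _ _ h'
    | tail _ h' ih => exact ih.trans (h _ _ h')
  exact lt_irrefl _ (this v v hv)

namespace BoolModule

variable {S I : Type} (M : BoolModule S I)

/-- The configurations of the inputs, with the most recent one first. -/
def inputs {D : ℕ} (j : I × Fin D → Bool) : List (I → Bool) :=
  List.ofFn fun d α => j (α, d)

theorem length_inputs {D : ℕ} (j : I × Fin D → Bool) : (inputs j).length = D :=
  List.length_ofFn

variable {M}

theorem run_eq {D : ℕ} (x : S → Bool) (j : I × Fin D → Bool) {k : ℕ} (hk : k ≤ D) :
    M.run x j k hk = ((inputs j).take k).foldr (fun i y => M.update y i) x := by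
  rw [run, inputs]
  congr 1
  apply List.ext_getElem <;> simp [hk]

/-- A longer run with the same last inputs is a shorter run from another configuration, so that
the function which gives the state of an automaton is unique. -/
theorem GivesState.unique {s : S} {D : ℕ} {O O' : (I × Fin D → Bool) → Bool}
    (h : M.GivesState s O) (h' : M.GivesState s O') : O = O' := by
  obtain ⟨k, hk, h⟩ := h
  obtain ⟨k', hk', h'⟩ := h'
  wlog hkk : k ≤ k' generalizing k k' O O'
  · exact (this k' hk' h' k hk h (by omega)).symm
  funext j
  obtain ⟨l, rfl⟩ := Nat.exists_eq_add_of_le hkk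
  rw [h' (fun _ => false) j, run_eq, List.take_add, List.foldr_append, ← run_eq _ _ hk, ← h]

theorem GivesState.isOutputFunction {s : S} {D : ℕ} {O : (I × Fin D → Bool) → Bool}
    (h : M.GivesState s O) : M.IsOutputFunction s O :=
  ⟨h, fun _ h' => (congrArg delay (h.unique h')).le⟩

/-- After more updates than the rank of an automaton in the interaction digraph, the state of this
automaton does not depend on the initial configuration. -/
theorem foldr_update_eq [Finite S] [Finite I] {r : S → ℕ} (hr : ∀ s t, M.Arc s t → r s < r t)
    (x x' : S → Bool) (l : List (I → Bool)) {t : S} (ht : r t < l.length) :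
    l.foldr (fun i y => M.update y i) x t = l.foldr (fun i y => M.update y i) x' t := by
  induction l generalizing t with
  | nil => simp at ht
  | cons i l ih =>
    refine eq_of_forall_influences fun a ha => ?_
    rcases a with s | α
    · have := hr s t ha
      exact ih (by simp at ht; omega)
    · rfl

end BoolModule

/-! ### Circuits on other sets of nodes -/

/-- The gate with its predecessors renamed. -/
def Gate.map {A V W : Type} (f : V → W) : Gate A V → Gate A W
  | .var a => .var a
  | .not u => .not (f u)
  | .and us => .and (us.map f)
  | .or us => .or (us.map f)

theorem Gate.preds_map {A V W : Type} (f : V → W) (g : Gate A V) :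
    (g.map f).preds = g.preds.map f := by
  cases g <;> rfl

theorem Gate.eval_map {A V W : Type} (f : V → W) (g : Gate A V) (x : A → Bool) (val : W → Bool) :
    (g.map f).eval x val = g.eval x (val ∘ f) := by
  cases g <;> simp [Gate.map, Gate.eval]

theorem Gate.eval_congr {A V : Type} {g : Gate A V} {x : A → Bool} {val val' : V → Bool}
    (h : ∀ u ∈ g.preds, val u = val' u) : g.eval x val = g.eval x val' := by
  cases g with
  | var a => rfl
  | not u => simp [Gate.eval, h u (by simp [Gate.preds])]
  | and us =>
    rw [Bool.eq_iff_iff]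
    simp only [Gate.eval, List.all_eq_true]
    exact forall₂_congr fun u hu => by rw [h u hu]
  | or us =>
    rw [Bool.eq_iff_iff]
    simp only [Gate.eval, List.any_eq_true]
    exact exists_congr fun u => and_congr_right fun hu => by rw [h u hu]

/-- The code of a gate whose predecessors `u` have the numbers `idx u`. -/
def encodeGateBy {A V : Type} (e : A → List Letter) (idx : V → ℕ) : Gate A V → List Letter
  | .var a => e a
  | .not u => Letter.not :: encodeNum (idx u)
  | .and us => Letter.and :: encodeList (fun u => encodeNum (idx u)) us
  | .or us => Letter.or :: encodeList (fun u => encodeNum (idx u)) us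

theorem encodeGate_map {A V : Type} (e : A → List Letter) {N : ℕ} (f : V → Fin N) (g : Gate A V) :
    encodeGate e (g.map f) = encodeGateBy e (fun u => (f u : ℕ)) g := by
  cases g <;> simp [Gate.map, encodeGate, encodeGateBy, encodeList, List.flatMap_map]

namespace Circuit

variable {A V : Type}

/-- The circuit with gates `g` and output `o`, where the nodes are numbered by their positions
`idx` in the list `l`. -/
def ofNodes (g : V → Gate A V) (l : List V) (idx : V → ℕ) (hl : ∀ v, l[idx v]? = some v)
    (hg : ∀ v, (g v).preds = [] → ∃ a, g v = .var a)
    (hc : CycleFree fun u v => u ∈ (g v).preds) (o : V) : Circuit A where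
  size := l.length
  gate i := (g l[i]).map fun v => ⟨idx v, (List.getElem?_eq_some_iff.1 (hl v)).1⟩
  output := ⟨idx o, (List.getElem?_eq_some_iff.1 (hl o)).1⟩
  var_of_preds_eq_nil i h := by
    obtain ⟨a, ha⟩ := hg l[i] (by simpa [Gate.preds_map] using h)
    exact ⟨a, by simp only [ha, Gate.map]⟩
  acyclic i hi := by
    refine hc l[i] (Relation.TransGen.lift (fun i : Fin l.length => l[i]) ?_ _ _ hi)
    intro i j hij
    simp only [Gate.preds_map, List.mem_map] at hij
    obtain ⟨u, hu, rfl⟩ := hij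
    simpa [Function.onFun, (List.getElem?_eq_some_iff.1 (hl u)).2] using hu

variable {g : V → Gate A V} {l : List V} {idx : V → ℕ} {hl : ∀ v, l[idx v]? = some v}
  {hg : ∀ v, (g v).preds = [] → ∃ a, g v = .var a} {hc : CycleFree fun u v => u ∈ (g v).preds}
  {o : V}

theorem value_ofNodes {x : A → Bool} {val : V → Bool} (h : ∀ v, val v = (g v).eval x val)
    (i : Fin l.length) : (ofNodes g l idx hl hg hc o).value x i = val l[i] := by
  refine (ofNodes g l idx hl hg hc o).wellFounded_arc.induction
    (C := fun i => (ofNodes g l idx hl hg hc o).value x i = val l[i]) i fun i ih => ?_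
  rw [value_eq, h]
  refine (Gate.eval_map (W := Fin (ofNodes g l idx hl hg hc o).size) _ (g l[i]) x _).trans ?_
  refine Gate.eval_congr fun u hu => ?_
  have := ih ⟨idx u, (List.getElem?_eq_some_iff.1 (hl u)).1⟩
    (by
      simp only [ofNodes, Gate.preds_map]
      exact List.mem_map_of_mem hu)
  exact this.trans (congrArg val (List.getElem?_eq_some_iff.1 (hl u)).2)

/-- Values that obey the gates are the values computed by the circuit. -/
theorem eval_ofNodes {x : A → Bool} {val : V → Bool} (h : ∀ v, val v = (g v).eval x val) :
    (ofNodes g l idx hl hg hc o).eval x = val o := by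
  refine (value_ofNodes h _).trans ?_
  simp [ofNodes, (List.getElem?_eq_some_iff.1 (hl o)).2]

theorem encodeCircuit_ofNodes (e : A → List Letter) :
    encodeCircuit e (ofNodes g l idx hl hg hc o) =
      encodeList (fun v => encodeGateBy e idx (g v)) l ++ encodeNum (idx o) := by
  have : List.ofFn (ofNodes g l idx hl hg hc o).gate = l.map fun v =>
      (g v).map fun v => ⟨idx v, (List.getElem?_eq_some_iff.1 (hl v)).1⟩ :=
    List.ofFn_getElem_eq_map l fun v => (g v).map fun v =>
      (⟨idx v, (List.getElem?_eq_some_iff.1 (hl v)).1⟩ : Fin l.length)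
  rw [encodeCircuit, this, encodeList, List.flatMap_map]
  simp only [encodeGate_map]
  rfl

end Circuit

/-! ### The unrolled circuit -/

theorem getElem?_flatMap {α β : Type} {f : α → List β} {l : List α} {i : ℕ} {a : α}
    (ha : l[i]? = some a) {j : ℕ} (hj : j < (f a).length) :
    (l.flatMap f)[((l.take i).map fun a => (f a).length).sum + j]? = (f a)[j]? := by
  induction l generalizing i with
  | nil => simp at ha
  | cons b l ih =>
    cases i with
    | zero =>
      obtain rfl : b = a := by simpa using ha
      simp [List.getElem?_append_left hj]
    | succ i =>
      rw [← ih (i := i) (by simpa using ha)]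
      simp [List.getElem?_append, Nat.add_assoc]

namespace ModuleInput

variable (P : ModuleInput)

/-- The nodes of the unrolled circuit. In the layer `d < n`, which stands for the update of delay
`d + 1`, there are a copy of the circuit of each automaton, and a node `relay d t` which repeats the
output of the copy of the circuit of `t`, the state of `t` after this update. The nodes `relay n t`
stand for the initial configuration. -/
inductive Node : Type
  | relay (d : Fin (P.n + 1)) (t : Fin P.n)
  | copy (d t : Fin P.n) (v : Fin (P.circuit t).size)

/-- The number of the nodes of the circuits of the automata before `t`. -/
def offset (t : ℕ) : ℕ :=
  (((List.finRange P.n).take t).map fun s => (P.circuit s).size).sum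

/-- The number of the nodes of a layer. -/
def width : ℕ :=
  P.n + P.offset P.n

namespace Node

variable {P}

/-- The number of a node. -/
def idx : P.Node → ℕ
  | relay d t => d * P.width + t
  | copy d t v => d * P.width + (P.n + (P.offset t + v))

/-- The gate that is put in the layer `d` instead of a gate of the circuit of `t`. -/
def copyGate (d t : Fin P.n) :
    Gate (Fin P.n ⊕ Fin P.m) (Fin (P.circuit t).size) → Gate (Fin P.m × Fin P.n) P.Node
  | .var (.inl s) => .and [relay d.succ s]
  | .var (.inr α) => .var (α, d)
  | .not u => .not (copy d t u)
  | .and us => .and (us.map (copy d t))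
  | .or us => .or (us.map (copy d t))

/-- The gates of the unrolled circuit. The variable `z` is put instead of the initial states. -/
def gate (z : Fin P.m × Fin P.n) : P.Node → Gate (Fin P.m × Fin P.n) P.Node
  | relay d t =>
    if hd : d < P.n then .and [copy ⟨d, hd⟩ t (P.circuit t).output] else .var z
  | copy d t v => copyGate d t ((P.circuit t).gate v)

theorem var_of_preds_gate {z : Fin P.m × Fin P.n} (v : P.Node) (h : (gate z v).preds = []) :
    ∃ a, gate z v = .var a := by
  cases v with
  | relay d t =>
    by_cases hd : d < P.n
    · simp [gate, hd, Gate.preds] at h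
    · exact ⟨z, by simp [gate, hd]⟩
  | copy d t v =>
    have := (P.circuit t).var_of_preds_eq_nil v
    revert h this
    cases hv : (P.circuit t).gate v with
    | var a => cases a <;> simp [gate, hv, copyGate, Gate.preds]
    | _ => simp +contextual [gate, hv, copyGate, Gate.preds]

theorem cycleFree_gate (z : Fin P.m × Fin P.n) :
    CycleFree fun u v => u ∈ (gate z v).preds := by
  choose r hr hlt using fun t => (P.circuit t).acyclic.exists_rank
  -- The nodes are ranked by their layers, then by their ranks in the circuits.
  refine cycleFree_of_rank (β := ℕ ×ₗ ℕ) (fun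
    | relay d t => toLex (P.n - d, (P.circuit t).size)
    | copy d t v => toLex (P.n - d, r t v)) fun u v huv => ?_
  cases v with
  | relay d t =>
    by_cases hd : d < P.n
    · obtain rfl : u = _ := by simpa [gate, hd, Gate.preds] using huv
      simpa [Prod.Lex.toLex_lt_toLex] using hlt t _
    · simp [gate, hd, Gate.preds] at huv
  | copy d t v =>
    have hr := hr t
    cases hv : (P.circuit t).gate v with
    | var a =>
      cases a with
      | inl s =>
        obtain rfl : u = _ := by simpa [gate, hv, copyGate, Gate.preds] using huv
        simp only [Prod.Lex.toLex_lt_toLex]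
        left
        simp
        omega
      | inr α => simp [gate, hv, copyGate, Gate.preds] at huv
    | not w =>
      obtain rfl : u = _ := by simpa [gate, hv, copyGate, Gate.preds] using huv
      simpa [Prod.Lex.toLex_lt_toLex] using hr w v (by simp [hv, Gate.preds])
    | _ us =>
      obtain ⟨w, hw, rfl⟩ : ∃ w ∈ us, copy d t w = u := by
        simpa [gate, hv, copyGate, Gate.preds] using huv
      simpa [Prod.Lex.toLex_lt_toLex] using hr w v (by simpa [hv, Gate.preds] using hw)

variable (P) in
/-- The nodes of the layer `d`, in order. -/
def layer (d : Fin P.n) : List P.Node :=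
  (List.finRange P.n).map (relay d.castSucc) ++
    (List.finRange P.n).flatMap fun t => (List.finRange (P.circuit t).size).map (copy d t)

variable (P) in
/-- The nodes, in order. -/
def all : List P.Node :=
  (List.finRange P.n).flatMap (layer P) ++ (List.finRange P.n).map (relay (Fin.last P.n))

theorem offset_add_lt (t : Fin P.n) (v : Fin (P.circuit t).size) :
    P.offset t + v < P.offset P.n := by
  have h : P.offset (t + 1) ≤ P.offset P.n := by
    refine (((List.take_sublist_take_left t.2).map _)).sum_le_sum fun _ _ => Nat.zero_le _
  refine lt_of_lt_of_le ?_ h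
  simp [offset, List.take_add_one]

theorem length_layer (d : Fin P.n) : (layer P d).length = P.width := by
  simp [layer, width, offset, List.length_flatMap, List.take_of_length_le]

theorem getElem?_layer_relay (d t : Fin P.n) :
    (layer P d)[(t : ℕ)]? = some (relay d.castSucc t) := by
  simp [layer, List.getElem?_append]

theorem getElem?_layer_copy (d t : Fin P.n) (v : Fin (P.circuit t).size) :
    (layer P d)[P.n + (P.offset t + v)]? = some (copy d t v) := by
  rw [layer, List.getElem?_append_right (by simp)]
  have := getElem?_flatMap (f := fun t => (List.finRange (P.circuit t).size).map (copy d t))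
    (l := List.finRange P.n) (i := t) (a := t) (by simp) (j := v) (by simp)
  simpa [offset] using this

theorem getElem?_all_layer (d : Fin P.n) {i : ℕ} (hi : i < P.width) :
    (all P)[d * P.width + i]? = (layer P d)[i]? := by
  have := getElem?_flatMap (f := layer P)
    (l := List.finRange P.n) (i := d) (a := d) (by simp) (j := i) (by rwa [length_layer])
  rw [← this, all]
  simp only [length_layer, List.map_const', List.sum_replicate, smul_eq_mul, List.length_take,
    List.length_finRange, min_eq_left d.2.le]
  refine List.getElem?_append_left ?_
  simp only [List.length_flatMap, length_layer, List.map_const', List.sum_replicate, smul_eq_mul,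
    List.length_finRange]
  calc d * P.width + i < d * P.width + P.width := by omega
    _ = (d + 1) * P.width := by ring
    _ ≤ P.n * P.width := Nat.mul_le_mul_right _ d.2

theorem getElem?_all_idx (v : P.Node) : (all P)[v.idx]? = some v := by
  cases v with
  | relay d t =>
    induction d using Fin.lastCases with
    | last =>
      rw [all, List.getElem?_append_right] <;>
        simp [List.length_flatMap, length_layer, idx]
    | cast d =>
      rw [idx, Fin.val_castSucc, getElem?_all_layer, getElem?_layer_relay]
      exact lt_of_lt_of_le t.2 (Nat.le_add_right _ _)
  | copy d t v =>
    rw [idx, getElem?_all_layer, getElem?_layer_copy]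
    exact Nat.add_lt_add_left (offset_add_lt t v) _

end Node

/-- The unrolled circuit, with the state of `s` after the last update as output. -/
noncomputable def unrolled (z : Fin P.m × Fin P.n) (s : Fin P.n) : Circuit (Fin P.m × Fin P.n) :=
  Circuit.ofNodes (Node.gate z) (Node.all P) Node.idx Node.getElem?_all_idx Node.var_of_preds_gate
    (Node.cycleFree_gate z) (.relay 0 s)

variable {P}

/-- The circuit computes the state after `n` updates from the configuration in which all the states
are the value of `z`. -/
theorem eval_unrolled (z : Fin P.m × Fin P.n) (s : Fin P.n) (j : Fin P.m × Fin P.n → Bool) :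
    (P.unrolled z s).eval j = P.toModule.run (fun _ => j z) j P.n le_rfl s := by
  let y : ℕ → Fin P.n → Bool := fun d =>
    ((BoolModule.inputs j).drop d).foldr (fun i y => P.toModule.update y i) fun _ => j z
  have hy : ∀ d : Fin P.n, y d = P.toModule.update (y (d + 1)) fun α => j (α, d) := fun d => by
    have hd : (d : ℕ) < (BoolModule.inputs j).length := by rw [BoolModule.length_inputs]; exact d.2
    simp only [y]
    rw [List.drop_eq_getElem_cons hd]
    simp [BoolModule.inputs]
  let val : P.Node → Bool
    | .relay d t => y d t
    | .copy d t v => (P.circuit t).value (Sum.elim (y (d + 1)) fun α => j (α, d)) v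
  have h : ∀ v, val v = (Node.gate z v).eval j val := by
    intro v
    cases v with
    | relay d t =>
      by_cases hd : d < P.n
      · have := congrFun (hy ⟨d, hd⟩) t
        simpa [Node.gate, hd, Gate.eval, val, BoolModule.update, toModule, Circuit.eval] using this
      · obtain rfl : d = Fin.last P.n := Fin.ext (by simp; omega)
        simp [Node.gate, Gate.eval, val, y,
          List.drop_of_length_le (BoolModule.length_inputs j).le]
    | copy d t v =>
      refine ((P.circuit t).value_eq _ v).trans ?_
      cases hv : (P.circuit t).gate v with
      | var a => cases a <;> simp [Node.gate, Node.copyGate, Gate.eval, val, hv]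
      | _ => simp [Node.gate, Node.copyGate, Gate.eval, val, hv, Function.comp_def]
  rw [unrolled, Circuit.eval_ofNodes h, BoolModule.run_eq,
    List.take_of_length_le (BoolModule.length_inputs j).le]
  rfl

/-- As each path of the interaction digraph has at most `n` nodes, the initial configuration is
forgotten after `n` updates. -/
theorem givesState_unrolled (z : Fin P.m × Fin P.n) (s : Fin P.n) :
    P.toModule.GivesState s (P.unrolled z s).eval := by
  obtain ⟨r, hr, hlt⟩ := P.acyclic.exists_rank
  refine ⟨P.n, le_rfl, fun x j => ?_⟩
  rw [eval_unrolled, BoolModule.run_eq, BoolModule.run_eq]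
  refine BoolModule.foldr_update_eq (M := P.toModule) hr _ _ _ ?_
  simpa [BoolModule.length_inputs] using hlt s

/-- A module with automata but without inputs would not be acyclic: the circuit of each automaton
has a variable, which influences it. -/
theorem m_pos (hP : ∀ s, (P.circuit s).OnlyEssential) (s : Fin P.n) : 0 < P.m := by
  obtain ⟨r, hr, -⟩ := P.acyclic.exists_rank
  -- An automaton of minimal rank only depends on inputs.
  obtain ⟨t, -, ht⟩ := Finset.exists_min_image Finset.univ r ⟨s, Finset.mem_univ s⟩
  obtain ⟨q, hq, -⟩ := (P.circuit t).acyclic.exists_rank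
  obtain ⟨v, -, hv⟩ := Finset.exists_min_image Finset.univ q
    ⟨(P.circuit t).output, Finset.mem_univ _⟩
  obtain ⟨a, ha⟩ := (P.circuit t).var_of_preds_eq_nil v (List.eq_nil_iff_forall_not_mem.2
    fun u hu => (hv u (Finset.mem_univ u)).not_gt (hq u v hu))
  have := (hP t a).1 ⟨v, ha⟩
  rcases a with a | α
  · exact absurd (hr a t this) (ht a (Finset.mem_univ a)).not_gt
  · exact α.pos

end ModuleInput

/-! ### Transductions -/

section Transduce

variable {σ Γ : Type}

/-- The case of `scan` in which the words only depend on the state and on the letter. -/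
def transduce (δ : σ → Γ → σ) (g : σ → Γ → List Γ) : σ → List Γ → List Γ
  | _, [] => []
  | q, a :: r => g q a ++ transduce δ g (δ q a) r

theorem scan_eq_transduce (δ : σ → Γ → σ) (g : σ → Γ → List Γ) (q : σ) (p x : List Γ) :
    scan δ (fun q a _ _ => g q a) q p x = transduce δ g q x := by
  induction x generalizing q p with
  | nil => rfl
  | cons a x ih => simp [scan, transduce, ih]

theorem transduce_append (δ : σ → Γ → σ) (g : σ → Γ → List Γ) (q : σ) (u v : List Γ) :
    transduce δ g q (u ++ v) = transduce δ g q u ++ transduce δ g (u.foldl δ q) v := by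
  induction u generalizing q with
  | nil => rfl
  | cons a u ih => simp [transduce, ih]

theorem scan_append (δ : σ → Γ → σ) (g : σ → Γ → List Γ → List Γ → List Γ) (q : σ)
    (p u v : List Γ) :
    scan δ g q p (u ++ v) = scan δ (fun q a p r => g q a p (r ++ v)) q p u ++
      scan δ g (u.foldl δ q) (u.reverse ++ p) v := by
  induction u generalizing q p with
  | nil => rfl
  | cons a u ih => simp [scan, ih]

/-- A scan writes nothing where a transduction, which is easier to compute, writes nothing. -/
theorem scan_eq_nil {δ : σ → Γ → σ} {g : σ → Γ → List Γ → List Γ → List Γ} {h : σ → Γ → List Γ}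
    {x : List Γ} (hgh : ∀ q, ∀ a ∈ x, h q a = [] → ∀ p r, g q a p r = []) {q : σ} {p : List Γ}
    (hx : transduce δ h q x = []) : scan δ g q p x = [] := by
  induction x generalizing q p with
  | nil => rfl
  | cons a x ih =>
    obtain ⟨h₁, h₂⟩ := List.append_eq_nil_iff.1 hx
    rw [scan, hgh q a (by simp) h₁, ih (fun q b hb => hgh q b (by simp [hb])) h₂, List.nil_append]

theorem transduce_unit_eq_flatMap (g : Γ → List Γ) (x : List Γ) :
    transduce (fun _ _ => ()) (fun _ a => g a) () x = x.flatMap g := by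
  induction x with
  | nil => rfl
  | cons a x ih => simp [transduce, ih]

variable [Fintype σ] [Fintype Γ] {n : ℕ} {x : (Fin n → List Γ) → List Γ}

theorem PolyTime.transduce (δ : σ → Γ → σ) {g : σ → Γ → (Fin n → List Γ) → List Γ}
    (hg : ∀ q a, PolyTime (g q a)) (hx : PolyTime x) (q : σ) :
    PolyTime fun v => AutomataNetwork.transduce δ (fun q a => g q a v) q (x v) := by
  have := PolyTime.scan δ (g := fun q a _ _ v => g q a v)
    (fun q a => (hg q a).rename fun i => i.succ.succ) hx q
  simpa only [scan_eq_transduce] using this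

theorem PolyTime.flatMap {g : Γ → (Fin n → List Γ) → List Γ} (hg : ∀ a, PolyTime (g a))
    (hx : PolyTime x) : PolyTime fun v => (x v).flatMap fun a => g a v := by
  have := PolyTime.transduce (σ := Unit) (fun _ _ => ()) (g := fun _ a => g a) (fun _ => hg) hx ()
  simpa only [transduce_unit_eq_flatMap] using this

end Transduce

variable {n : ℕ} {x : (Fin n → List Letter) → List Letter}

/-- The number that a word starts with. -/
def firstNum (w : List Letter) : List Letter :=
  w.takeWhile (· = .tick)

theorem PolyTime.firstNum (hx : PolyTime x) : PolyTime fun v => firstNum (x v) := by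
  have h : ∀ b w, AutomataNetwork.transduce (fun b a => b && decide (a = Letter.tick))
      (fun b a => if b && decide (a = Letter.tick) then [a] else []) b w =
        if b then AutomataNetwork.firstNum w else [] := by
    intro b w
    induction w generalizing b with
    | nil => cases b <;> rfl
    | cons a w ih =>
      rw [AutomataNetwork.transduce, ih]
      cases b <;> by_cases ha : a = .tick <;> simp [AutomataNetwork.firstNum, ha]
  have := PolyTime.transduce (σ := Bool) (n := n) (fun b a => b && decide (a = Letter.tick))
    (g := fun b a _ => if b && decide (a = Letter.tick) then [a] else []) (fun q a => const _) hx
    true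
  simpa only [h, if_true] using this

/-- The word after the first `mark`. -/
def afterMark (w : List Letter) : List Letter :=
  (w.dropWhile (· ≠ .mark)).tail

theorem PolyTime.afterMark (hx : PolyTime x) : PolyTime fun v => afterMark (x v) := by
  have h : ∀ b w, AutomataNetwork.transduce (fun b a => b || decide (a = Letter.mark))
      (fun b a => if b then [a] else []) b w =
        if b then w else AutomataNetwork.afterMark w := by
    intro b w
    induction w generalizing b with
    | nil => cases b <;> rfl
    | cons a w ih =>
      rw [AutomataNetwork.transduce, ih]
      cases b <;> by_cases ha : a = .mark <;> simp [AutomataNetwork.afterMark, ha]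
  have := PolyTime.transduce (σ := Bool) (n := n) (fun b a => b || decide (a = Letter.mark))
    (g := fun b a _ => if b then [a] else []) (fun q a => const _) hx false
  simpa [h] using this

/-- The letters that start the code of a gate. -/
def Letter.isGate : Letter → Bool
  | .node | .input | .not | .and | .or => true
  | _ => false

/-- The number of the gates in a word, in unary. -/
def gateCount (w : List Letter) : List Letter :=
  w.flatMap fun a => if a.isGate then [.tick] else []

theorem PolyTime.gateCount (hx : PolyTime x) : PolyTime fun v => gateCount (x v) :=
  PolyTime.flatMap (fun _ => const _) hx

theorem gateCount_eq (w : List Letter) :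
    gateCount w = List.replicate (w.countP Letter.isGate) .tick := by
  induction w with
  | nil => rfl
  | cons a w ih =>
    rw [gateCount, List.flatMap_cons, ← gateCount, ih]
    cases h : a.isGate <;> simp [h, List.replicate_succ]

/-! ### Reading the code of a module -/

/-- The states of a finite automaton that reads the codes of the circuits, and then the list of
the output nodes: at the start of a circuit, between two gates, in the number of an automaton, in
the number of an input, in the predecessor of a negation, in the predecessors of a conjunction or
disjunction, in the number of the output of a circuit, in the list of the output nodes. -/
inductive Pos : Type
  | start | gates | nodeVar | inputVar | pred | preds | out | nodes
  deriving DecidableEq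

instance : Fintype Pos :=
  ⟨{.start, .gates, .nodeVar, .inputVar, .pred, .preds, .out, .nodes},
    fun x => by cases x <;> decide⟩

/-- The transitions, where the state after a circuit is `after`. -/
def Pos.next (after : Pos) : Pos → Letter → Pos
  | .start, .node | .gates, .node => .nodeVar
  | .start, .input | .gates, .input => .inputVar
  | .start, .not | .gates, .not => .pred
  | .start, .and | .gates, .and => .preds
  | .start, .or | .gates, .or => .preds
  | .start, _ => .nodes
  | .gates, .close => .out
  | .nodeVar, .mark | .inputVar, .mark | .pred, .mark | .preds, .close => .gates
  | .out, .mark => after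
  | q, _ => q

section Reading

variable {after : Pos} {g : Pos → Letter → List Letter}

theorem foldl_encodeNum {σ : Type} {δ : σ → Letter → σ} {q : σ} (h : δ q .tick = q) (k : ℕ) :
    (encodeNum k).foldl δ q = δ q .mark := by
  induction k with
  | zero => rfl
  | succ k ih => simpa [encodeNum, List.replicate_succ, h] using ih

theorem transduce_encodeNum {σ : Type} {δ : σ → Letter → σ} {g : σ → Letter → List Letter} {q : σ}
    (h : δ q .tick = q) (k : ℕ) :
    transduce δ g q (encodeNum k) = (List.replicate k (g q .tick)).flatten ++ g q .mark := by
  induction k with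
  | zero => simp [encodeNum, transduce]
  | succ k ih => simpa [encodeNum, List.replicate_succ, transduce, h] using ih

theorem foldl_preds {N : ℕ} (us : List (Fin N)) :
    (encodeList (fun u : Fin N => encodeNum u) us).foldl (Pos.next after) .preds = .gates := by
  rw [encodeList, List.foldl_append]
  induction us with
  | nil => rfl
  | cons u us ih =>
    rw [List.flatMap_cons, List.foldl_append, foldl_encodeNum rfl]
    exact ih

theorem transduce_preds {N : ℕ} (us : List (Fin N)) :
    transduce (Pos.next after) g .preds (encodeList (fun u : Fin N => encodeNum u) us) =
      us.flatMap (fun u : Fin N => (List.replicate u (g .preds .tick)).flatten ++ g .preds .mark) ++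
        g .preds .close := by
  rw [encodeList]
  induction us with
  | nil => simp [transduce]
  | cons u us ih =>
    rw [List.flatMap_cons, List.append_assoc, transduce_append, transduce_encodeNum rfl,
      foldl_encodeNum rfl, List.flatMap_cons]
    simp only [List.append_assoc]
    exact congrArg _ (congrArg _ ih)

theorem foldl_encodeGate {q : Pos} (hq : q = .start ∨ q = .gates) {n m N : ℕ}
    (G : Gate (Fin n ⊕ Fin m) (Fin N)) :
    (encodeGate encodeVar G).foldl (Pos.next after) q = .gates := by
  cases G with
  | var a => cases a <;> rcases hq with rfl | rfl <;> exact foldl_encodeNum rfl _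
  | not u => rcases hq with rfl | rfl <;> exact foldl_encodeNum rfl _
  | _ us => rcases hq with rfl | rfl <;> exact foldl_preds us

/-- The words written when a gate is read. -/
theorem transduce_encodeGate {q : Pos} (hq : q = .start ∨ q = .gates) {n m N : ℕ}
    (G : Gate (Fin n ⊕ Fin m) (Fin N)) :
    transduce (Pos.next after) g q (encodeGate encodeVar G) = match G with
      | .var (.inl s) =>
        g q .node ++ ((List.replicate s (g .nodeVar .tick)).flatten ++ g .nodeVar .mark)
      | .var (.inr α) =>
        g q .input ++ ((List.replicate α (g .inputVar .tick)).flatten ++ g .inputVar .mark)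
      | .not u => g q .not ++ ((List.replicate u (g .pred .tick)).flatten ++ g .pred .mark)
      | .and us => g q .and ++ (us.flatMap (fun u : Fin N =>
          (List.replicate u (g .preds .tick)).flatten ++ g .preds .mark) ++ g .preds .close)
      | .or us => g q .or ++ (us.flatMap (fun u : Fin N =>
          (List.replicate u (g .preds .tick)).flatten ++ g .preds .mark) ++ g .preds .close) := by
  cases G with
  | var a =>
    cases a <;> rcases hq with rfl | rfl <;> exact congrArg _ (transduce_encodeNum rfl _)
  | not u => rcases hq with rfl | rfl <;> exact congrArg _ (transduce_encodeNum rfl _)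
  | _ us => rcases hq with rfl | rfl <;> exact congrArg _ (transduce_preds us)

theorem foldl_gates {n m N : ℕ} (l : List (Gate (Fin n ⊕ Fin m) (Fin N))) :
    (l.flatMap (encodeGate encodeVar)).foldl (Pos.next after) .gates = .gates := by
  induction l with
  | nil => rfl
  | cons G l ih => rw [List.flatMap_cons, List.foldl_append, foldl_encodeGate (.inr rfl), ih]

variable {n m : ℕ} (C : Circuit (Fin n ⊕ Fin m))

theorem exists_gates_eq_cons : ∃ G l, List.ofFn C.gate = G :: l :=
  List.exists_cons_of_ne_nil (by simpa using C.output.pos.ne')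

theorem exists_encodeCircuit_eq_cons :
    ∃ a l, encodeCircuit encodeVar C = a :: l ∧ a.isGate := by
  obtain ⟨G, l, h⟩ := exists_gates_eq_cons C
  rw [encodeCircuit, encodeList, h, List.flatMap_cons]
  rcases G with (a | a) | u | us | us <;> exact ⟨_, _, rfl, rfl⟩

theorem foldl_encodeCircuit :
    (encodeCircuit encodeVar C).foldl (Pos.next after) .start = after := by
  obtain ⟨G, l, h⟩ := exists_gates_eq_cons C
  rw [encodeCircuit, encodeList, h, List.flatMap_cons, List.foldl_append, List.foldl_append,
    List.foldl_append, foldl_encodeGate (.inl rfl), foldl_gates]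
  exact foldl_encodeNum rfl _

/-- The words written when a circuit is read, if the same word `f G` is written for a gate `G`
whether this gate is the first one or not. -/
theorem transduce_encodeCircuit {q : Pos} (hq : q = .start ∨ q = .gates)
    {f : Gate (Fin n ⊕ Fin m) (Fin C.size) → List Letter}
    (hf : ∀ q', q' = q ∨ q' = .gates → ∀ G,
      transduce (Pos.next after) g q' (encodeGate encodeVar G) = f G) :
    transduce (Pos.next after) g q (encodeCircuit encodeVar C) =
      (List.ofFn C.gate).flatMap f ++ (g .gates .close ++
        ((List.replicate C.output (g .out .tick)).flatten ++ g .out .mark)) := by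
  have hl : ∀ l : List (Gate (Fin n ⊕ Fin m) (Fin C.size)),
      transduce (Pos.next after) g .gates (l.flatMap (encodeGate encodeVar)) = l.flatMap f := by
    intro l
    induction l with
    | nil => rfl
    | cons G l ih =>
      rw [List.flatMap_cons, transduce_append, foldl_encodeGate (.inr rfl), ih, hf _ (.inr rfl),
        List.flatMap_cons]
  have ho : transduce (Pos.next after) g .gates ([.close] ++ encodeNum C.output) =
      g .gates .close ++ ((List.replicate C.output (g .out .tick)).flatten ++ g .out .mark) :=
    congrArg _ (transduce_encodeNum rfl _)
  obtain ⟨G, l, h⟩ := exists_gates_eq_cons C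
  rw [encodeCircuit, encodeList, h, List.flatMap_cons, List.append_assoc, List.append_assoc,
    transduce_append, foldl_encodeGate hq, transduce_append, foldl_gates, ho, hl,
    hf _ (.inl rfl), List.flatMap_cons, List.append_assoc]

theorem countP_encodeNum (k : ℕ) : (encodeNum k).countP Letter.isGate = 0 := by
  simp [encodeNum, List.countP_append, List.countP_replicate, Letter.isGate]

theorem countP_nums {N : ℕ} (us : List (Fin N)) :
    (encodeList (fun u : Fin N => encodeNum u) us).countP Letter.isGate = 0 := by
  rw [encodeList]
  induction us with
  | nil => rfl
  | cons u us ih =>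
    rw [List.flatMap_cons, List.append_assoc, List.countP_append, countP_encodeNum, ih]

theorem countP_encodeGate {N : ℕ} (G : Gate (Fin n ⊕ Fin m) (Fin N)) :
    (encodeGate encodeVar G).countP Letter.isGate = 1 := by
  cases G with
  | var a => cases a <;> exact (List.countP_cons_of_pos rfl).trans (congrArg (· + 1) (countP_encodeNum _))
  | not u => exact (List.countP_cons_of_pos rfl).trans (congrArg (· + 1) (countP_encodeNum _))
  | _ us => exact (List.countP_cons_of_pos rfl).trans (congrArg (· + 1) (countP_nums us))

theorem countP_encodeCircuit : (encodeCircuit encodeVar C).countP Letter.isGate = C.size := by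
  have : ∀ l : List (Gate (Fin n ⊕ Fin m) (Fin C.size)),
      (l.flatMap (encodeGate encodeVar)).countP Letter.isGate = l.length := by
    intro l
    induction l with
    | nil => rfl
    | cons G l ih =>
      rw [List.flatMap_cons, List.countP_append, ih, countP_encodeGate, List.length_cons, add_comm]
  rw [encodeCircuit, encodeList, List.countP_append, List.countP_append, this, countP_encodeNum]
  simp [Letter.isGate]

end Reading

/-! ### Writing the unrolled circuit -/

/-- The words written when a circuit is copied: `base` is added to the numbers of the predecessors,
`next` to the numbers of the automata, which become predecessors, and `delay` is the delay of the
inputs. -/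
def copyLetter (base next delay : List Letter) : Pos → Letter → List Letter
  | .start, .node | .gates, .node => [.and]
  | .start, .input | .gates, .input => [.input]
  | .start, .not | .gates, .not => [.not]
  | .start, .and | .gates, .and => [.and]
  | .start, .or | .gates, .or => [.or]
  | .nodeVar, .tick | .inputVar, .tick | .pred, .tick | .preds, .tick => [.tick]
  | .nodeVar, .mark => next ++ [.mark, .close]
  | .inputVar, .mark => [.mark] ++ (delay ++ [.mark])
  | .pred, .mark | .preds, .mark => base ++ [.mark]
  | .preds, .close => [.close]
  | _, _ => []

/-- The words written when a circuit is replaced by a node which repeats its output. -/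
def relayLetter (base : List Letter) : Pos → Letter → List Letter
  | .gates, .close => [.and]
  | .out, .tick => [.tick]
  | .out, .mark => base ++ [.mark, .close]
  | _, _ => []

/-- The copy of the circuit that a word starts with. -/
def copyCircuit (base next delay w : List Letter) : List Letter :=
  transduce (Pos.next .nodes) (copyLetter base next delay) .start w

/-- The node which repeats the output of the circuit that a word starts with. -/
def relayCircuit (base w : List Letter) : List Letter :=
  transduce (Pos.next .nodes) (relayLetter base) .start w

/-- The words `F c r` for each circuit, where `c` is the number of the gates of the circuits before
it and `r` is the word from its code on. -/
def eachCircuit (F : List Letter → List Letter → List Letter) (w : List Letter) : List Letter :=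
  scan (Pos.next .start)
    (fun q a p r => if q = .start ∧ a.isGate then F (gateCount p) ([a] ++ r) else []) .start [] w

/-- The layer after `d` layers of width `W`, for the circuits of the word `w`, where `N` is the
number of automata. -/
def writeLayer (N W d w : List Letter) : List Letter :=
  eachCircuit (fun c r => relayCircuit (d.flatMap (fun _ => W) ++ (N ++ c)) r) w ++
    eachCircuit (fun c r => copyCircuit (d.flatMap (fun _ => W) ++ (N ++ c))
      (d.flatMap (fun _ => W) ++ W) (d ++ [.tick]) r) w

/-- The gates of the unrolled circuit. -/
def writeGates (N W w : List Letter) : List Letter :=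
  scan (fun _ _ => ()) (fun _ _ p _ => writeLayer N W p w) () [] N ++
    (N.flatMap (fun _ => [.input, .mark, .tick, .mark]) ++ [.close])

/-- For each number in the list of the output nodes, this number, the word `G`, and this number
again. -/
def writeNodes (G w : List Letter) : List Letter :=
  scan (Pos.next .start) (fun q a p _ => if (q = .start ∨ q = .nodes) ∧ a = .mark then
    firstNum p ++ ([.mark] ++ (G ++ (firstNum p ++ [.mark]))) else []) .start [] w

/-- The code of the output. -/
def writeOutput (w : List Letter) : List Letter :=
  writeNodes (writeGates (firstNum w) (firstNum w ++ gateCount w) (afterMark (afterMark w)))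
    (afterMark (afterMark w))

namespace PolyTime

variable {n : ℕ} {x y z u : (Fin n → List Letter) → List Letter}

theorem copyCircuit (hx : PolyTime x) (hy : PolyTime y) (hz : PolyTime z) (hu : PolyTime u) :
    PolyTime fun v => copyCircuit (x v) (y v) (z v) (u v) :=
  PolyTime.transduce (Pos.next .nodes) (g := fun q a v => copyLetter (x v) (y v) (z v) q a)
    (fun q a => by
      cases q <;> cases a <;> first
        | exact const _
        | exact hx.append (const _)
        | exact hy.append (const _)
        | exact (const [.mark]).append (hz.append (const _))) hu .start

theorem relayCircuit (hx : PolyTime x) (hu : PolyTime u) :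
    PolyTime fun v => relayCircuit (x v) (u v) :=
  PolyTime.transduce (Pos.next .nodes) (g := fun q a v => relayLetter (x v) q a)
    (fun q a => by
      cases q <;> cases a <;> first
        | exact const _
        | exact hx.append (const _)) hu .start

theorem eachCircuit {F : List Letter → List Letter → (Fin n → List Letter) → List Letter}
    (hF : ∀ c r : (Fin (n + 2) → List Letter) → List Letter, PolyTime c → PolyTime r →
      PolyTime fun v => F (c v) (r v) fun i => v i.succ.succ) (hu : PolyTime u) :
    PolyTime fun v => eachCircuit (fun c r => F c r v) (u v) :=
  scan (Pos.next .start) (g := fun q a p r v => if q = .start ∧ a.isGate then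
    F (AutomataNetwork.gateCount p) ([a] ++ r) v else []) (fun q a => by
      by_cases h : q = .start ∧ a.isGate
      · simp only [h, and_self, if_true]
        exact hF _ _ (gateCount (var 0)) ((const [a]).append (var 1))
      · simp only [h, if_false]
        exact nil) hu .start

theorem writeLayer (hx : PolyTime x) (hy : PolyTime y) (hz : PolyTime z) (hu : PolyTime u) :
    PolyTime fun v => writeLayer (x v) (y v) (z v) (u v) := by
  have hzy := flatMap (g := fun _ => y) (fun _ => hy) hz
  refine append ?_ ?_
  · exact eachCircuit (F := fun c r v => AutomataNetwork.relayCircuit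
      ((z v).flatMap (fun _ => y v) ++ (x v ++ c)) r)
      (fun c r hc hr => relayCircuit ((hzy.rename _).append ((hx.rename _).append hc)) hr) hu
  · exact eachCircuit (F := fun c r v => AutomataNetwork.copyCircuit
      ((z v).flatMap (fun _ => y v) ++ (x v ++ c)) ((z v).flatMap (fun _ => y v) ++ y v)
        (z v ++ [.tick]) r)
      (fun c r hc hr => copyCircuit ((hzy.rename _).append ((hx.rename _).append hc))
        ((hzy.append hy).rename _) ((hz.append (const _)).rename _) hr) hu

theorem writeGates (hx : PolyTime x) (hy : PolyTime y) (hu : PolyTime u) :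
    PolyTime fun v => writeGates (x v) (y v) (u v) :=
  append (scan (fun _ _ => ()) (g := fun _ _ p _ v => AutomataNetwork.writeLayer (x v) (y v) p (u v))
    (fun _ _ => writeLayer (hx.rename _) (hy.rename _) (var 0) (hu.rename _)) hx ())
    ((flatMap (fun _ => const _) hx).append (const _))

theorem writeNodes (hx : PolyTime x) (hu : PolyTime u) :
    PolyTime fun v => writeNodes (x v) (u v) :=
  scan (Pos.next .start) (g := fun q a p _ v => if (q = .start ∨ q = .nodes) ∧ a = .mark then
    AutomataNetwork.firstNum p ++ ([Letter.mark] ++ (x v ++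
      (AutomataNetwork.firstNum p ++ [Letter.mark]))) else []) (fun q a => by
      by_cases h : (q = .start ∨ q = .nodes) ∧ a = .mark
      · simp only [h, and_self, if_true]
        exact (firstNum (var 0)).append
          ((const _).append ((hx.rename _).append ((firstNum (var 0)).append (const _))))
      · simp only [h, if_false]
        exact nil) hu .start

theorem writeOutput : PolyTime fun v : Fin 1 → List Letter => writeOutput (v 0) :=
  have h := afterMark (afterMark (var (n := 1) 0))
  writeNodes (writeGates (firstNum (var 0)) ((firstNum (var 0)).append (gateCount (var 0))) h) h

end PolyTime

/-! ### The code of the output -/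

theorem transduce_eq_nil {σ Γ : Type} {δ : σ → Γ → σ} {g : σ → Γ → List Γ}
    (hg : ∀ q a, g q a = []) (q : σ) (x : List Γ) : transduce δ g q x = [] := by
  induction x generalizing q with
  | nil => rfl
  | cons a x ih => rw [transduce, hg, ih, List.nil_append]

/-- With `nodes` as the state after a circuit, only the first circuit of a word is transduced. -/
theorem transduce_nodes {g : Pos → Letter → List Letter} (hg : ∀ a, g .nodes a = [])
    (r : List Letter) : transduce (Pos.next .nodes) g .nodes r = [] := by
  induction r with
  | nil => rfl
  | cons a r ih => exact (congrArg₂ _ (hg a) ih :)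

namespace ModuleInput

variable (P : ModuleInput)

theorem relayCircuit_encodeCircuit (d t : Fin P.n) (z : Fin P.m × Fin P.n) (r : List Letter) :
    relayCircuit (List.replicate (d * P.width + (P.n + P.offset t)) .tick)
        (encodeCircuit encodeVar (P.circuit t) ++ r) =
      encodeGateBy encodeDelayedVar Node.idx (Node.gate z (.relay d.castSucc t)) := by
  rw [relayCircuit, transduce_append, foldl_encodeCircuit, transduce_nodes fun a => by cases a <;> rfl,
    List.append_nil, transduce_encodeCircuit _ (.inl rfl) (f := fun _ => [])]
  · have : ((d : ℕ) * P.width + (P.n + (P.offset t + (P.circuit t).output))) =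
        (P.circuit t).output + (d * P.width + (P.n + P.offset t)) := by ring
    simp [relayLetter, encodeList, encodeNum, Node.gate, encodeGateBy, Node.idx, this,
      List.replicate_add, -List.replicate_append_replicate]
  · intro q hq G
    rw [transduce_encodeGate hq]
    rcases G with (a | a) | u | us | us <;> rcases hq with rfl | rfl <;> simp [relayLetter]

theorem copyCircuit_encodeCircuit (d t : Fin P.n) (z : Fin P.m × Fin P.n) (r : List Letter) :
    copyCircuit (List.replicate (d * P.width + (P.n + P.offset t)) .tick)
        (List.replicate ((d + 1) * P.width) .tick) (List.replicate (d + 1) .tick)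
        (encodeCircuit encodeVar (P.circuit t) ++ r) =
      (List.finRange (P.circuit t).size).flatMap fun v =>
        encodeGateBy encodeDelayedVar Node.idx (Node.gate z (.copy d t v)) := by
  have idx_copy : ∀ u, Node.idx (.copy d t u) = u + (d * P.width + (P.n + P.offset t)) := fun u => by
    simp only [Node.idx]
    ring
  have idx_relay : ∀ s, Node.idx (.relay d.succ s) = s + (d + 1) * P.width := fun s => by
    simp only [Node.idx, Fin.val_succ]
    ring
  rw [copyCircuit, transduce_append, foldl_encodeCircuit, transduce_nodes fun a => by cases a <;> rfl,
    List.append_nil, transduce_encodeCircuit _ (.inl rfl)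
      (f := fun G => encodeGateBy encodeDelayedVar Node.idx (Node.copyGate d t G))]
  · simp [copyLetter, List.ofFn_eq_map, List.flatMap_map, Node.gate]
  · intro q hq G
    rw [transduce_encodeGate hq]
    rcases G with (a | a) | u | us | us <;> rcases hq with rfl | rfl <;>
      simp [copyLetter, Node.copyGate, encodeGateBy, encodeList, encodeNum, idx_copy, idx_relay,
        List.replicate_add, -List.replicate_append_replicate, encodeDelayedVar, List.flatMap_map]

/-- The codes of the circuits and of the output nodes. -/
def body : List Letter :=
  (List.finRange P.n).flatMap (fun s => encodeCircuit encodeVar (P.circuit s)) ++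
    encodeList (fun s : Fin P.n => encodeNum s) P.nodes

theorem firstNum_encodeNum (k : ℕ) (w : List Letter) :
    firstNum (encodeNum k ++ w) = List.replicate k .tick := by
  simp [firstNum, encodeNum]

theorem afterMark_encodeNum (k : ℕ) (w : List Letter) : afterMark (encodeNum k ++ w) = w := by
  simp [afterMark, encodeNum]

theorem encode_eq : P.encode = encodeNum P.n ++ (encodeNum P.m ++ P.body) := by
  simp [encode, body]

variable {P} in
theorem val_eq_length {l₁ l₂ : List (Fin P.n)} {t : Fin P.n}
    (h : List.finRange P.n = l₁ ++ t :: l₂) : (t : ℕ) = l₁.length := by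
  have := congrArg (·[l₁.length]?) h
  simp only [List.getElem?_append_right le_rfl, Nat.sub_self, List.getElem?_cons_zero] at this
  obtain ⟨_, h'⟩ := List.getElem?_eq_some_iff.1 this
  simp [← h']

variable {P} in
theorem offset_eq_sum {l₁ l₂ : List (Fin P.n)} {t : Fin P.n}
    (h : List.finRange P.n = l₁ ++ t :: l₂) :
    P.offset t = (l₁.map fun s => (P.circuit s).size).sum := by
  rw [offset, h, val_eq_length h, List.take_left]

/-- On the code of a module, the number of the gates before a circuit is its offset in a layer. -/
theorem eachCircuit_body {F : List Letter → List Letter → List Letter}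
    {E : Fin P.n → List Letter} (hF : ∀ (t : Fin P.n) r, F (List.replicate (P.offset t) .tick)
      (encodeCircuit encodeVar (P.circuit t) ++ r) = E t) :
    eachCircuit F P.body = (List.finRange P.n).flatMap E := by
  have key : ∀ l₂ l₁ : List (Fin P.n), List.finRange P.n = l₁ ++ l₂ → ∀ p : List Letter,
      p.countP Letter.isGate = (l₁.map fun s => (P.circuit s).size).sum →
      scan (Pos.next .start) (fun q a p r => if q = .start ∧ a.isGate then
        F (gateCount p) ([a] ++ r) else []) .start p
        (l₂.flatMap (fun s => encodeCircuit encodeVar (P.circuit s)) ++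
          encodeList (fun s : Fin P.n => encodeNum s) P.nodes) = l₂.flatMap E := by
    intro l₂
    induction l₂ with
    | nil =>
      intro l₁ _ p _
      refine scan_eq_nil (h := fun _ _ => []) (fun q a ha _ p r => ?_) ?_
      · have := List.countP_eq_zero.1 (countP_nums P.nodes) a (by simpa using ha)
        simp [this]
      · exact transduce_eq_nil (fun _ _ => rfl) _ _
    | cons t l₂ ih =>
      intro l₁ h p hp
      rw [List.flatMap_cons, List.append_assoc, List.flatMap_cons, scan_append,
        foldl_encodeCircuit, ih (l₁ ++ [t]) (by simpa using h) _ (by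
          simp [List.countP_append, countP_encodeCircuit, hp, add_comm])]
      congr 1
      -- Only the first letter of a circuit is a gate which is read in the state `start`.
      have hT := transduce_encodeCircuit (after := .start)
        (g := fun q _ => if q = .start then [.tick] else []) (P.circuit t) (.inr rfl)
        (f := fun _ => []) (fun q hq G => by
          obtain rfl : q = .gates := by simpa using hq
          rw [transduce_encodeGate (.inr rfl)]
          rcases G with (a | a) | u | us | us <;> simp)
      obtain ⟨a, l, hal, ha⟩ := exists_encodeCircuit_eq_cons (P.circuit t)
      have hnext : Pos.next .start .start a = Pos.next .start .gates a := by
        cases a <;> first | rfl | cases ha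
      rw [hal] at hT ⊢
      replace hT : transduce (Pos.next .start) (fun q _ => if q = .start then [.tick] else [])
        (Pos.next .start .start a) l = [] := by
        rw [hnext]
        simpa [transduce, List.flatMap_eq_nil_iff.2 fun _ _ => rfl] using hT
      rw [scan, scan_eq_nil (fun q b _ hq p r => ?_) hT, gateCount_eq, hp,
        ← offset_eq_sum h, ← hF t (l₂.flatMap (fun s => encodeCircuit encodeVar (P.circuit s)) ++
          encodeList (fun s : Fin P.n => encodeNum s) P.nodes), hal]
      · simp [ha]
      · refine if_neg ?_
        rintro ⟨rfl, -⟩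
        simp at hq
  exact key _ [] rfl [] rfl

theorem offset_eq_countP : P.offset P.n = P.encode.countP Letter.isGate := by
  have : ∀ l : List (Fin P.n), (l.flatMap fun s => encodeCircuit encodeVar (P.circuit s)).countP
      Letter.isGate = (l.map fun s => (P.circuit s).size).sum := by
    intro l
    induction l with
    | nil => rfl
    | cons t l ih => simp [List.countP_append, countP_encodeCircuit, ih]
  rw [encode_eq, body, List.countP_append, List.countP_append, List.countP_append,
    countP_encodeNum, countP_encodeNum, countP_nums, this, offset,
    List.take_of_length_le (by simp)]
  simp

theorem writeLayer_body (d : Fin P.n) (z : Fin P.m × Fin P.n) :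
    writeLayer (List.replicate P.n .tick) (List.replicate P.width .tick)
        (List.replicate d .tick) P.body =
      (Node.layer P d).flatMap fun v => encodeGateBy encodeDelayedVar Node.idx (Node.gate z v) := by
  have hmul : (List.replicate (d : ℕ) Letter.tick).flatMap (fun _ => List.replicate P.width .tick) =
      List.replicate (d * P.width) Letter.tick := by
    simp [List.flatMap_replicate]
  rw [writeLayer, hmul, eachCircuit_body (E := fun t =>
      encodeGateBy encodeDelayedVar Node.idx (Node.gate z (.relay d.castSucc t))),
    eachCircuit_body (E := fun t => (List.finRange (P.circuit t).size).flatMap fun v =>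
        encodeGateBy encodeDelayedVar Node.idx (Node.gate z (.copy d t v)))]
  · simp [Node.layer, List.flatMap_map, List.flatMap_assoc]
  · intro t r
    rw [← copyCircuit_encodeCircuit (r := r)]
    simp [add_mul, List.replicate_succ']
  · intro t r
    rw [← relayCircuit_encodeCircuit (r := r)]
    simp

/-- As the scan of `n` in unary gives `writeLayer` the prefixes of this word, the layers are written
in order. After them come the codes of the
first input with delay `1`, one for each node of the last layer. -/
theorem writeGates_body (hm : 0 < P.m) (hn : 0 < P.n) :
    writeGates (List.replicate P.n .tick) (List.replicate P.width .tick) P.body =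
      encodeList (fun v => encodeGateBy encodeDelayedVar Node.idx
        (Node.gate (⟨0, hm⟩, ⟨0, hn⟩) v)) (Node.all P) := by
  have key : ∀ l₂ l₁ : List (Fin P.n), List.finRange P.n = l₁ ++ l₂ →
      scan (fun _ _ => ()) (fun _ _ p _ => writeLayer (List.replicate P.n .tick)
        (List.replicate P.width .tick) p P.body) () (List.replicate l₁.length .tick)
        (List.replicate l₂.length .tick) = l₂.flatMap fun d => (Node.layer P d).flatMap fun v =>
          encodeGateBy encodeDelayedVar Node.idx (Node.gate (⟨0, hm⟩, ⟨0, hn⟩) v) := by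
    intro l₂
    induction l₂ with
    | nil => intro _ _; rfl
    | cons d l₂ ih =>
      intro l₁ h
      have := ih (l₁ ++ [d]) (by simpa using h)
      rw [List.length_append, List.length_singleton, List.replicate_succ] at this
      rw [List.length_cons, List.replicate_succ, scan, this, List.flatMap_cons,
        ← val_eq_length h, writeLayer_body]
  have h := key (List.finRange P.n) [] rfl
  rw [List.length_finRange] at h
  have hconst : ∀ w : List Letter, (List.finRange P.n).flatMap (fun _ => w) =
      (List.replicate P.n w).flatten := fun w => by
    rw [List.flatMap_def, List.map_const', List.length_finRange]
  rw [writeGates, encodeList, Node.all, List.flatMap_append, List.flatMap_assoc, ← h]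
  simp [List.flatMap_map, List.flatMap_replicate, Node.gate, encodeGateBy, encodeDelayedVar,
    encodeNum, hconst]

/-- On the code of a module, `writeNodes` writes nothing while it reads the circuits. At the end of
a number in the list of the output nodes, this number is what the reversed prefix starts with. -/
theorem writeNodes_body (G : List Letter) : writeNodes G P.body =
    P.nodes.flatMap fun s : Fin P.n => encodeNum s ++ (G ++ encodeNum s) := by
  set g : Pos → Letter → List Letter → List Letter → List Letter :=
    fun q a p _ => if (q = .start ∨ q = .nodes) ∧ a = .mark then
      firstNum p ++ ([.mark] ++ (G ++ (firstNum p ++ [.mark]))) else [] with hg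
  have num : ∀ (k i : ℕ) (q : Pos), q = .start ∨ q = .nodes → ∀ p r : List Letter,
      firstNum p = List.replicate i .tick →
      scan (Pos.next .start) g q p (encodeNum k ++ r) =
        encodeNum (i + k) ++ (G ++ encodeNum (i + k)) ++
          scan (Pos.next .start) g .nodes (.mark :: (List.replicate k .tick ++ p)) r := by
    intro k
    induction k with
    | zero =>
      intro i q hq p r hp
      rcases hq with rfl | rfl <;> simp [encodeNum, scan, hg, hp, Pos.next]
    | succ k ih =>
      intro i q hq p r hp
      have h := ih (i + 1) .nodes (.inr rfl) (.tick :: p) r (by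
        rw [firstNum] at hp ⊢
        simp [hp, List.replicate_succ])
      rw [show i + 1 + k = i + (k + 1) by ring] at h
      simp only [List.replicate_succ', List.append_assoc, List.singleton_append] at h ⊢
      rw [← h]
      rcases hq with rfl | rfl <;> simp [encodeNum, List.replicate_succ, scan, hg, Pos.next]
  have nums : ∀ (l : List (Fin P.n)) (q : Pos), q = .start ∨ q = .nodes → ∀ p : List Letter,
      firstNum p = [] → scan (Pos.next .start) g q p (encodeList (fun s : Fin P.n => encodeNum s) l) =
        l.flatMap fun s : Fin P.n => encodeNum s ++ (G ++ encodeNum s) := by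
    intro l
    induction l with
    | nil =>
      intro q hq p _
      simp [encodeList, scan, hg]
    | cons s l ih =>
      intro q hq p hp
      rw [encodeList, List.flatMap_cons, List.append_assoc, num s 0 q hq p _ hp, Nat.zero_add,
        ← encodeList, ih .nodes (.inr rfl) _ (by simp [firstNum]), List.flatMap_cons]
  -- Each circuit ends with a `mark`, so that the next number is not preceded by a `tick`.
  have circuits : ∀ (l : List (Fin P.n)) (p r : List Letter), firstNum p = [] →
      ∃ p', firstNum p' = [] ∧ scan (Pos.next .start) g .start p
        (l.flatMap (fun s => encodeCircuit encodeVar (P.circuit s)) ++ r) =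
          scan (Pos.next .start) g .start p' r := by
    intro l
    induction l with
    | nil => exact fun p r hp => ⟨p, hp, rfl⟩
    | cons t l ih =>
      intro p r _
      obtain ⟨p', hp', h⟩ := ih ((encodeCircuit encodeVar (P.circuit t)).reverse ++ p) r
        (by simp [encodeCircuit, encodeNum, firstNum])
      refine ⟨p', hp', ?_⟩
      rw [List.flatMap_cons, List.append_assoc, scan_append, foldl_encodeCircuit, h,
        scan_eq_nil (h := fun q a => if (q = .start ∨ q = .nodes) ∧ a = .mark then [.tick] else [])
          ?_ ?_, List.nil_append]
      · intro q a _ hq p r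
        by_cases h : (q = .start ∨ q = .nodes) ∧ a = .mark
        · simp [h] at hq
        · simp [hg, h]
      · rw [transduce_encodeCircuit _ (.inl rfl) (f := fun _ => [])]
        · simp
        · intro q hq G
          rw [transduce_encodeGate hq]
          rcases G with (a | a) | u | us | us <;> rcases hq with rfl | rfl <;> simp
  obtain ⟨p', hp', h⟩ := circuits (List.finRange P.n) []
    (encodeList (fun s : Fin P.n => encodeNum s) P.nodes) rfl
  exact h.trans (nums _ _ (.inl rfl) _ hp')

end ModuleInput

namespace ModuleInput

theorem writeOutput_encode (P : ModuleInput) :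
    writeOutput P.encode = P.nodes.flatMap fun s : Fin P.n => encodeNum s ++
      (writeGates (List.replicate P.n .tick) (List.replicate P.width .tick) P.body ++
        encodeNum s) := by
  have hW : firstNum P.encode ++ gateCount P.encode = List.replicate P.width .tick := by
    rw [gateCount_eq, ← offset_eq_countP, encode_eq, firstNum_encodeNum, ← List.replicate_add]
    rfl
  rw [writeOutput, hW, encode_eq, firstNum_encodeNum, afterMark_encodeNum, afterMark_encodeNum,
    writeNodes_body]

/-- The unrolled circuits of the output nodes. -/
noncomputable def unrolledOutput (P : ModuleInput) (hP : ∀ s, (P.circuit s).OnlyEssential) :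
    P.Output :=
  fun s => P.unrolled (⟨0, m_pos hP s.1⟩, ⟨0, s.1.pos⟩) s.1

theorem encodeOutput_unrolledOutput (P : ModuleInput) (hP : ∀ s, (P.circuit s).OnlyEssential) :
    P.encodeOutput (P.unrolledOutput hP) = writeOutput P.encode := by
  have h : ∀ s : Fin P.n, encodeCircuit encodeDelayedVar
      (P.unrolled (⟨0, m_pos hP s⟩, ⟨0, s.pos⟩) s) =
        writeGates (List.replicate P.n .tick) (List.replicate P.width .tick) P.body ++
          encodeNum s := fun s => by
    rw [unrolled, Circuit.encodeCircuit_ofNodes, writeGates_body P (m_pos hP s) s.pos]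
    simp [Node.idx]
  rw [writeOutput_encode, encodeOutput]
  simp only [unrolledOutput, h]
  conv_rhs => rw [← P.nodes.attach_map_subtype_val]
  rw [List.flatMap_map]

end ModuleInput

end AutomataNetwork

theorem mainTheorem3 : AutomataNetwork.outputCircuitComputation.InFP := by
  refine ⟨fun P => P.1.unrolledOutput P.2, fun P s =>
    (AutomataNetwork.ModuleInput.givesState_unrolled _ s.1).isOutputFunction, ?_⟩
  exact AutomataNetwork.PolyTime.writeOutput.computableInPolyTime
    (Γ := AutomataNetwork.Letter) fun P =>
      (AutomataNetwork.ModuleInput.encodeOutput_unrolledOutput P.1 P.2).symm
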